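/- Let $k$ be a field. A $k$-algebra (not necessarily associative or unital) is bicommutative if $x(yz)=y(xz)$ and $(xy)z=(xz)y$ for all $x,y,z$. Let $X=\{x_1,\dots,x_r\}$ be a set of $r>1$ letters and let $\mathrm{BC}(X)$ be the free bicommutative $k$-algebra on $X$. Let $[X]^+$ be the free commutative semigroup on $X$. For $u=z_1\cdots z_p$ and $v=y_1\cdots y_q$ in $[X]^+$ ($p,q\ge 1$) put $$[u;v]=z_1(z_2(\cdots(z_{p-1}((\cdots((z_py_1)y_2)\cdots)y_q))\cdots)).$$ The set $\mathrm{NF}(X)=X\cup\{[u;v]: u,v\in[X]^+\}$ is a linear basis of $\mathrm{BC}(X)$, with multiplication table $z\,y=[z;y]$, $z[u;v]=[zu;v]$, $[u;v]z=[u;vz]$, $[u;v][u';v']=[uu';vv']$ for $z,y\in X$. The length of a letter is $1$; the length of $[u;v]$ is the total number of letters of $u$ and $v$, counted with repetition. Fix any monomial order on $\mathrm{NF}(X)$, that is, a well order $<$ such that $\mu<\nu$ implies $\mu\rho<\nu\rho$ and $\rho\mu<\rho\nu$ for all $\rho\in\mathrm{NF}(X)$. For $0\neq f\in\mathrm{BC}(X)$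 let $\bar f$ be its leading (largest) monomial; $f$ is monic if the coefficient of $\bar f$ is $1$. Let $S\subseteq\mathrm{BC}(X)$ be a set of monic elements, let $\mathrm{Id}(S)$ be the two-sided ideal generated by $S$, and put $\mathrm{BC}(X|S)=\mathrm{BC}(X)/\mathrm{Id}(S)$. A normal $S$-polynomial is an element $s\in S$, or, if $s\in S$ and $\bar s$ has length at least $2$, any product $z_1(\cdots(z_p((\cdots(s\,y_1)\cdots)y_q))\cdots)$ with $p,q\ge 0$ and $z_i,y_j\in X$. The set $S$ is a Gröbner–Shirshov basis for $\mathrm{BC}(X|S)$ if for every nonzero $f\in\mathrm{Id}(S)$ there is a normal $S$-polynomial $h$ with $\bar f=\bar h$. For a $k$-algebra $B$ and a subspace $V\subseteq B$ put $V^1=V$, $V^n=\sum_{i=1}^{n-1}V^iV^{n-i}$ for $n\ge 2$ (where $VW$ is the span of all products $vw$ with $v\in V$, $w\in W$), and $V^{\le n}=V^1+\cdots+V^n$. Define $$\mathrm{GKdim}\,B=\sup_V\limsup_{n\to\infty}\log_n\dim_k V^{\le n},$$ where $V$ runs over all finite-dimensional subspaces of $B$, and $\mathrm{GKdim}\,0=0$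 by convention. Let $S=\{f_1,\dots,f_t\}$ be a finite Gröbner–Shirshov basis for $\mathrm{BC}(X|S)$ with exactly $t$ elements. Then: (i) if $1\le t\le r$ and no leading monomial $\bar f_i$ is a letter, then $\mathrm{GKdim}\,\mathrm{BC}(X|S)\in\{2r-t,2r-t+1,\dots,2r-1\}$; (ii) if $t>r$, then $\mathrm{GKdim}\,\mathrm{BC}(X|S)\in\{0,1,\dots,2r-1\}$. -/

import Mathlib

noncomputable section

namespace Bicomm

/-! ### Bicommutative multiplications -/

/-- A multiplication is bicommutative if it satisfies
`x(yz) = y(xz)` (left commutativity) and `(xy)z = (xz)y` (right commutativity). -/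
structure IsBicommutative (M : Type*) [Mul M] : Prop where
  left_comm : ∀ x y z : M, x * (y * z) = y * (x * z)
  right_comm : ∀ x y z : M, (x * y) * z = (x * z) * y

/-! ### Normal forms -/

/-- The set `NF(X)` of normal forms: the letters `x ∈ X` and the monomials `[u; v]` where `u`, `v`
are nonempty commutative words in `X`, that is, elements of the free commutative semigroup
`[X]⁺`, represented here as nonzero multisets. -/
inductive NF (X : Type*) : Type _
  | letter (x : X) : NF X
  | pair (u v : Multiset X) (hu : u ≠ 0) (hv : v ≠ 0) : NF X

namespace NF

variable {X : Type*}

/-- The length of a normal form, counted with repetition. -/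
def length : NF X → ℕ
  | letter _ => 1
  | pair u v _ _ => Multiset.card u + Multiset.card v

/-- The multiplication table of the normal forms:
`z y = [z; y]`, `z [u; v] = [z u; v]`, `[u; v] z = [u; v z]`, `[u; v] [u'; v'] = [u u'; v v']`. -/
def mul : NF X → NF X → NF X
  | letter z, letter y => pair {z} {y} (Multiset.singleton_ne_zero z) (Multiset.singleton_ne_zero y)
  | letter z, pair u v _ hv => pair (z ::ₘ u) v (Multiset.cons_ne_zero) hv
  | pair u v hu _, letter z => pair u (z ::ₘ v) hu (Multiset.cons_ne_zero)
  | pair u v hu hv, pair u' v' _ _ =>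
      pair (u + u') (v + v') (fun h => hu (add_eq_zero.1 h).1) (fun h => hv (add_eq_zero.1 h).1)

instance : Mul (NF X) := ⟨mul⟩

theorem letter_mul_letter (z y : X) : letter z * letter y =
    pair {z} {y} (Multiset.singleton_ne_zero z) (Multiset.singleton_ne_zero y) := rfl

theorem letter_mul_pair (z : X) (u v : Multiset X) (hu : u ≠ 0) (hv : v ≠ 0) :
    letter z * pair u v hu hv = pair (z ::ₘ u) v (Multiset.cons_ne_zero) hv := rfl

theorem pair_mul_letter (z : X) (u v : Multiset X) (hu : u ≠ 0) (hv : v ≠ 0) :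
    pair u v hu hv * letter z = pair u (z ::ₘ v) hu (Multiset.cons_ne_zero) := rfl

theorem pair_mul_pair (u v u' v' : Multiset X) (hu : u ≠ 0) (hv : v ≠ 0) (hu' : u' ≠ 0)
    (hv' : v' ≠ 0) : pair u v hu hv * pair u' v' hu' hv' =
      pair (u + u') (v + v') (fun h => hu (add_eq_zero.1 h).1)
        (fun h => hv (add_eq_zero.1 h).1) := rfl

theorem isBicommutative : IsBicommutative (NF X) where
  left_comm x y z := by
    cases x <;> cases y <;> cases z <;>
      simp only [letter_mul_letter, letter_mul_pair, pair_mul_letter, pair_mul_pair, pair.injEq,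
        ← Multiset.singleton_add] <;> constructor <;> first | trivial | ac_rfl
  right_comm x y z := by
    cases x <;> cases y <;> cases z <;>
      simp only [letter_mul_letter, letter_mul_pair, pair_mul_letter, pair_mul_pair, pair.injEq,
        ← Multiset.singleton_add] <;> constructor <;> first | trivial | ac_rfl

/-! ### The normal forms are the free bicommutative magma -/

section lift

variable {M : Type*} [Mul M]

theorem mid_assoc (hM : IsBicommutative M) (a b c d : M) :
    (a * (b * c)) * d = a * ((b * c) * d) := by
  rw [hM.left_comm a b c, hM.right_comm b (a * c) d, hM.left_comm (b * d) a c,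
    hM.right_comm b d c]

/-- Left multiplication by the letters of a word. -/
def mulL (hM : IsBicommutative M) (φ : X → M) (t : Multiset X) (b : M) : M :=
  haveI : LeftCommutative (fun (z : X) (b : M) => φ z * b) := ⟨fun _ _ _ => hM.left_comm _ _ _⟩
  t.foldr (fun z b => φ z * b) b

/-- Right multiplication by the letters of a word. -/
def mulR (hM : IsBicommutative M) (φ : X → M) (t : Multiset X) (b : M) : M :=
  haveI : LeftCommutative (fun (z : X) (b : M) => b * φ z) := ⟨fun _ _ _ => hM.right_comm _ _ _⟩
  t.foldr (fun z b => b * φ z) b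

variable (hM : IsBicommutative M) (φ : X → M)

theorem mulL_zero (b : M) : mulL hM φ 0 b = b := rfl

theorem mulR_zero (b : M) : mulR hM φ 0 b = b := rfl

theorem mulL_cons (z : X) (t : Multiset X) (b : M) :
    mulL hM φ (z ::ₘ t) b = φ z * mulL hM φ t b := by
  simp [mulL]

theorem mulR_cons (z : X) (t : Multiset X) (b : M) :
    mulR hM φ (z ::ₘ t) b = mulR hM φ t b * φ z := by
  simp [mulR]

theorem mulL_add (s t : Multiset X) (b : M) :
    mulL hM φ (s + t) b = mulL hM φ s (mulL hM φ t b) := by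
  simp [mulL]

theorem mulR_add (s t : Multiset X) (b : M) :
    mulR hM φ (s + t) b = mulR hM φ s (mulR hM φ t b) := by
  simp [mulR]

theorem mul_mulL (t : Multiset X) (a b : M) : a * mulL hM φ t b = mulL hM φ t (a * b) := by
  induction t using Multiset.induction with
  | empty => rfl
  | cons z t ih => rw [mulL_cons, mulL_cons, hM.left_comm, ih]

theorem mulR_mul (t : Multiset X) (a b : M) : mulR hM φ t b * a = mulR hM φ t (b * a) := by
  induction t using Multiset.induction with
  | empty => rfl
  | cons z t ih => rw [mulR_cons, mulR_cons, hM.right_comm, ih]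

theorem exists_mulL (t : Multiset X) (c d : M) : ∃ a b, mulL hM φ t (c * d) = a * b := by
  induction t using Multiset.induction with
  | empty => exact ⟨c, d, rfl⟩
  | cons z t ih => exact ⟨_, _, mulL_cons hM φ z t _⟩

theorem exists_mulR (t : Multiset X) (c d : M) : ∃ a b, mulR hM φ t (c * d) = a * b := by
  induction t using Multiset.induction with
  | empty => exact ⟨c, d, rfl⟩
  | cons z t ih => exact ⟨_, _, mulR_cons hM φ z t _⟩

theorem mul_mulR (t : Multiset X) (a c d : M) :
    a * mulR hM φ t (c * d) = mulR hM φ t (a * (c * d)) := by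
  induction t using Multiset.induction with
  | empty => rfl
  | cons z t ih =>
    obtain ⟨e, f, h⟩ := exists_mulR hM φ t c d
    rw [mulR_cons, mulR_cons, ← ih, h, mid_assoc hM]

theorem mulL_mul (t : Multiset X) (a c d : M) :
    mulL hM φ t (c * d) * a = mulL hM φ t (c * d * a) := by
  induction t using Multiset.induction with
  | empty => rfl
  | cons z t ih =>
    obtain ⟨e, f, h⟩ := exists_mulL hM φ t c d
    rw [mulL_cons, mulL_cons, ← ih, h, mid_assoc hM]

theorem mulR_mulL (s t : Multiset X) (c d : M) :
    mulR hM φ s (mulL hM φ t (c * d)) = mulL hM φ t (mulR hM φ s (c * d)) := by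
  induction t using Multiset.induction with
  | empty => rfl
  | cons z t ih =>
    obtain ⟨e, f, h⟩ := exists_mulL hM φ t c d
    rw [mulL_cons, mulL_cons, ← ih, h, mul_mulR]

theorem bracket_congr {z z' y y' : X} {t t' s s' : Multiset X} (h : z ::ₘ t = z' ::ₘ t')
    (h' : y ::ₘ s = y' ::ₘ s') :
    mulL hM φ t (mulR hM φ s (φ z * φ y)) = mulL hM φ t' (mulR hM φ s' (φ z' * φ y')) := by
  have h1 : mulL hM φ t (mulR hM φ s (φ z * φ y)) = mulL hM φ t' (mulR hM φ s (φ z' * φ y)) := by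
    rcases Multiset.cons_eq_cons.1 h with ⟨rfl, rfl⟩ | ⟨-, r, rfl, rfl⟩
    · rfl
    · rw [mulL_cons, mulL_cons, mul_mulL, mul_mulL, mul_mulR, mul_mulR, hM.left_comm]
  have h2 : mulR hM φ s (φ z' * φ y) = mulR hM φ s' (φ z' * φ y') := by
    rcases Multiset.cons_eq_cons.1 h' with ⟨rfl, rfl⟩ | ⟨-, r, rfl, rfl⟩
    · rfl
    · rw [mulR_cons, mulR_cons, mulR_mul, mulR_mul, hM.right_comm]
  rw [h1, h2]

theorem exists_eq_cons {u : Multiset X} (hu : u ≠ 0) : ∃ z t, u = z ::ₘ t := by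
  obtain ⟨z, hz⟩ := Multiset.exists_mem_of_ne_zero hu
  exact ⟨z, Multiset.exists_cons_of_mem hz⟩

/-- The value of a normal form in a bicommutative magma. -/
def eval : NF X → M
  | letter x => φ x
  | pair _ _ hu hv =>
      mulL hM φ (exists_eq_cons hu).choose_spec.choose
        (mulR hM φ (exists_eq_cons hv).choose_spec.choose
          (φ (exists_eq_cons hu).choose * φ (exists_eq_cons hv).choose))

theorem eval_pair {u v : Multiset X} (hu : u ≠ 0) (hv : v ≠ 0) {z y : X} {t s : Multiset X}
    (h : u = z ::ₘ t) (h' : v = y ::ₘ s) :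
    eval hM φ (pair u v hu hv) = mulL hM φ t (mulR hM φ s (φ z * φ y)) :=
  bracket_congr hM φ ((exists_eq_cons hu).choose_spec.choose_spec.symm.trans h)
    ((exists_eq_cons hv).choose_spec.choose_spec.symm.trans h')

theorem eval_mul (μ ν : NF X) : eval hM φ (μ * ν) = eval hM φ μ * eval hM φ ν := by
  cases μ with
  | letter z =>
    cases ν with
    | letter y =>
      exact eval_pair hM φ _ _ (z := z) (y := y) (t := 0) (s := 0) rfl rfl
    | pair u v hu hv =>
      obtain ⟨a, t, rfl⟩ := exists_eq_cons hu
      obtain ⟨b, s, rfl⟩ := exists_eq_cons hv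
      rw [letter_mul_pair, eval_pair hM φ _ _ (Multiset.cons_swap z a t) rfl,
        eval_pair hM φ _ _ rfl rfl, mulL_cons]
      rfl
  | pair u v hu hv =>
    obtain ⟨a, t, rfl⟩ := exists_eq_cons hu
    obtain ⟨b, s, rfl⟩ := exists_eq_cons hv
    cases ν with
    | letter z =>
      obtain ⟨e, f, h⟩ := exists_mulR hM φ s (φ a) (φ b)
      rw [pair_mul_letter, eval_pair hM φ _ _ rfl (Multiset.cons_swap z b s),
        eval_pair hM φ _ _ rfl rfl, mulR_cons, h, ← mulL_mul]
      rfl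
    | pair u' v' hu' hv' =>
      obtain ⟨a', t', rfl⟩ := exists_eq_cons hu'
      obtain ⟨b', s', rfl⟩ := exists_eq_cons hv'
      have e1 : a ::ₘ t + a' ::ₘ t' = a ::ₘ (t' + a' ::ₘ t) := by
        simp only [← Multiset.singleton_add]; ac_rfl
      have e2 : b ::ₘ s + b' ::ₘ s' = b ::ₘ (s' + b' ::ₘ s) := by
        simp only [← Multiset.singleton_add]; ac_rfl
      rw [pair_mul_pair, eval_pair hM φ _ _ e1 e2, eval_pair hM φ _ _ rfl rfl,
        eval_pair hM φ _ _ rfl rfl, mul_mulL, mul_mulR, hM.left_comm _ (φ a') (φ b'),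
        mulL_add, mulR_add]
      obtain ⟨e, f, h⟩ := exists_mulR hM φ s (φ a) (φ b)
      rw [h, mulL_mul, ← h, ← mulR_cons, ← mulL_cons]
      obtain ⟨e', f', h'⟩ := exists_mulR hM φ (b' ::ₘ s) (φ a) (φ b)
      rw [h', mulR_mulL]

/-- Two multiplicative maps on the normal forms that agree on the letters are equal. -/
theorem hom_ext {F G : NF X →ₙ* M} (h : ∀ x, F (letter x) = G (letter x)) : F = G := by
  have key : ∀ (z y : X) (t s : Multiset X),
      F (pair (z ::ₘ t) (y ::ₘ s) Multiset.cons_ne_zero Multiset.cons_ne_zero) =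
        G (pair (z ::ₘ t) (y ::ₘ s) Multiset.cons_ne_zero Multiset.cons_ne_zero) := by
    intro z y t s
    induction t using Multiset.induction generalizing z with
    | empty =>
      induction s using Multiset.induction generalizing y with
      | empty =>
        change F (letter z * letter y) = G (letter z * letter y)
        rw [map_mul, map_mul, h, h]
      | cons w s ih =>
        have e := pair_mul_letter y (z ::ₘ 0) (w ::ₘ s) Multiset.cons_ne_zero Multiset.cons_ne_zero
        rw [← e, map_mul, map_mul, ih, h]
    | cons w t ih =>
      have e := letter_mul_pair z (w ::ₘ t) (y ::ₘ s) Multiset.cons_ne_zero Multiset.cons_ne_zero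
      rw [← e, map_mul, map_mul, ih, h]
  ext μ
  cases μ with
  | letter x => exact h x
  | pair u v hu hv =>
    obtain ⟨a, t, rfl⟩ := exists_eq_cons hu
    obtain ⟨b, s, rfl⟩ := exists_eq_cons hv
    exact key a b t s

end lift

end NF

/-! ### The free bicommutative algebra -/

/-- The free bicommutative algebra `BC(X)` over `k`: the vector space with basis `NF(X)`, whose
product is the bilinear extension of the multiplication table of the normal forms. It is
bicommutative (`BC.isBicommutative`) and it has the universal property of the free bicommutative
algebra on `X` (`BC.existsUnique_lift`). -/
abbrev BC (k X : Type*) [Field k] : Type _ := MonoidAlgebra k (NF X)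

namespace BC

variable {k X : Type*} [Field k]

/-- The generator of `BC(X)` given by a letter. -/
def of (k : Type*) {X : Type*} [Field k] (x : X) : BC k X := MonoidAlgebra.single (NF.letter x) 1

theorem isBicommutative (k X : Type*) [Field k] : IsBicommutative (BC k X) where
  left_comm a b c := by
    induction a using MonoidAlgebra.induction_linear with
    | zero => simp
    | add f g hf hg => simp only [add_mul, mul_add, hf, hg]
    | single μ p =>
    induction b using MonoidAlgebra.induction_linear with
    | zero => simp
    | add f g hf hg => simp only [add_mul, mul_add, hf, hg]
    | single ν q =>
    induction c using MonoidAlgebra.induction_linear with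
    | zero => simp
    | add f g hf hg => simp only [mul_add, hf, hg]
    | single ρ r =>
      simp only [MonoidAlgebra.single_mul_single, NF.isBicommutative.left_comm μ ν ρ,
        mul_left_comm p q r]
  right_comm a b c := by
    induction a using MonoidAlgebra.induction_linear with
    | zero => simp
    | add f g hf hg => simp only [add_mul, hf, hg]
    | single μ p =>
    induction b using MonoidAlgebra.induction_linear with
    | zero => simp
    | add f g hf hg => simp only [add_mul, mul_add, hf, hg]
    | single ν q =>
    induction c using MonoidAlgebra.induction_linear with
    | zero => simp
    | add f g hf hg => simp only [add_mul, mul_add, hf, hg]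
    | single ρ r =>
      simp only [MonoidAlgebra.single_mul_single, NF.isBicommutative.right_comm μ ν ρ,
        mul_right_comm p q r]

/-- Universal property: every map from `X` to a bicommutative algebra extends uniquely to an
algebra homomorphism on `BC(X)`. -/
theorem existsUnique_lift {A : Type*} [NonUnitalNonAssocRing A] [Module k A] [IsScalarTower k A A]
    [SMulCommClass k A A] (hA : IsBicommutative A) (φ : X → A) :
    ∃! F : BC k X →ₙₐ[k] A, ∀ x, F (of k x) = φ x := by
  refine ⟨MonoidAlgebra.liftMagma k ⟨NF.eval hA φ, NF.eval_mul hA φ⟩, fun x => ?_, ?_⟩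
  · simp [of, MonoidAlgebra.liftMagma, NF.eval]
  · intro G hG
    rw [← Equiv.symm_apply_eq]
    refine NF.hom_ext fun x => ?_
    exact hG x

/-- In `BC(X)` the basis element `[z t; y s]` is the bracketed product
`z₁ (⋯ (z_p ((⋯ ((z y) y₁) ⋯) y_q)) ⋯)`, where `t = z₁ ⋯ z_p` and `s = y₁ ⋯ y_q`. -/
theorem single_pair (z y : X) (t s : Multiset X) :
    (MonoidAlgebra.single (NF.pair (z ::ₘ t) (y ::ₘ s) Multiset.cons_ne_zero
        Multiset.cons_ne_zero) 1 : BC k X) =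
      NF.mulL (isBicommutative k X) (of k) t
        (NF.mulR (isBicommutative k X) (of k) s (of k z * of k y)) := by
  rw [← NF.eval_pair (isBicommutative k X) (of k) Multiset.cons_ne_zero Multiset.cons_ne_zero
    rfl rfl]
  have e : MonoidAlgebra.ofMagma k (NF X) =
      (⟨NF.eval (isBicommutative k X) (of k), NF.eval_mul (isBicommutative k X) (of k)⟩ :
        NF X →ₙ* BC k X) := NF.hom_ext fun x => rfl
  exact DFunLike.congr_fun e _

end BC

/-! ### Ideals and quotient algebras -/

/-- A (two-sided) ideal of a not necessarily associative algebra: a linear subspace that absorbs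
multiplication from both sides. -/
structure AlgIdeal (k A : Type*) [Field k] [NonUnitalNonAssocRing A] [Module k A] extends
    Submodule k A where
  mul_mem_left : ∀ a b : A, b ∈ carrier → a * b ∈ carrier
  mul_mem_right : ∀ a b : A, a ∈ carrier → a * b ∈ carrier

namespace AlgIdeal

variable {k A : Type*} [Field k] [NonUnitalNonAssocRing A] [Module k A]

/-- The ideal `Id(S)` generated by a set `S`: the intersection of all ideals that contain `S`. -/
def span (k : Type*) {A : Type*} [Field k] [NonUnitalNonAssocRing A] [Module k A] (S : Set A) :
    AlgIdeal k A where
  toSubmodule := sInf {p | ∃ I : AlgIdeal k A, I.toSubmodule = p ∧ S ⊆ (I.toSubmodule : Set A)}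
  mul_mem_left a b hb := by
    rw [AddSubsemigroup.mem_carrier, AddSubmonoid.mem_toSubsemigroup,
      Submodule.mem_toAddSubmonoid, Submodule.mem_sInf] at hb ⊢
    rintro _ ⟨I, rfl, hI⟩
    exact I.mul_mem_left a b (hb _ ⟨I, rfl, hI⟩)
  mul_mem_right a b ha := by
    rw [AddSubsemigroup.mem_carrier, AddSubmonoid.mem_toSubsemigroup,
      Submodule.mem_toAddSubmonoid, Submodule.mem_sInf] at ha ⊢
    rintro _ ⟨I, rfl, hI⟩
    exact I.mul_mem_right a b (ha _ ⟨I, rfl, hI⟩)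

/-- The quotient of an algebra by an ideal. -/
def Quotient (I : AlgIdeal k A) : Type _ := A ⧸ I.toSubmodule

variable (I : AlgIdeal k A)

instance : AddCommGroup I.Quotient := inferInstanceAs (AddCommGroup (A ⧸ I.toSubmodule))

instance : Module k I.Quotient := inferInstanceAs (Module k (A ⧸ I.toSubmodule))

/-- The quotient map. -/
def proj : A →ₗ[k] I.Quotient := I.toSubmodule.mkQ

theorem proj_surjective : Function.Surjective I.proj := I.toSubmodule.mkQ_surjective

theorem proj_eq_proj {a b : A} : I.proj a = I.proj b ↔ a - b ∈ I.toSubmodule :=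
  Submodule.Quotient.eq I.toSubmodule

instance : Mul I.Quotient where
  mul := Quotient.map₂ (· * ·) (by
    intro a a' ha b b' hb
    have ha' : a - a' ∈ I.toSubmodule := (Submodule.quotientRel_def _).1 ha
    have hb' : b - b' ∈ I.toSubmodule := (Submodule.quotientRel_def _).1 hb
    refine (Submodule.quotientRel_def _).2 ?_
    have e : a * b - a' * b' = (a - a') * b + a' * (b - b') := by
      rw [sub_mul, mul_sub]; abel
    rw [e]
    exact add_mem (I.mul_mem_right _ _ ha') (I.mul_mem_left _ _ hb'))

theorem proj_mul (a b : A) : I.proj (a * b) = I.proj a * I.proj b := rfl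

instance : NonUnitalNonAssocRing I.Quotient where
  left_distrib a b c := by
    obtain ⟨a, rfl⟩ := I.proj_surjective a
    obtain ⟨b, rfl⟩ := I.proj_surjective b
    obtain ⟨c, rfl⟩ := I.proj_surjective c
    simp only [← map_add, ← proj_mul, mul_add]
  right_distrib a b c := by
    obtain ⟨a, rfl⟩ := I.proj_surjective a
    obtain ⟨b, rfl⟩ := I.proj_surjective b
    obtain ⟨c, rfl⟩ := I.proj_surjective c
    simp only [← map_add, ← proj_mul, add_mul]
  zero_mul a := by
    obtain ⟨a, rfl⟩ := I.proj_surjective a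
    rw [← map_zero I.proj, ← proj_mul, zero_mul]
  mul_zero a := by
    obtain ⟨a, rfl⟩ := I.proj_surjective a
    rw [← map_zero I.proj, ← proj_mul, mul_zero]

instance [IsScalarTower k A A] : IsScalarTower k I.Quotient I.Quotient where
  smul_assoc c a b := by
    obtain ⟨a, rfl⟩ := I.proj_surjective a
    obtain ⟨b, rfl⟩ := I.proj_surjective b
    simp only [smul_eq_mul, ← map_smul, ← proj_mul, smul_mul_assoc]

instance [SMulCommClass k A A] : SMulCommClass k I.Quotient I.Quotient where
  smul_comm c a b := by
    obtain ⟨a, rfl⟩ := I.proj_surjective a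
    obtain ⟨b, rfl⟩ := I.proj_surjective b
    simp only [smul_eq_mul, ← map_smul, ← proj_mul, mul_smul_comm]

end AlgIdeal

/-- The bicommutative algebra `BC(X | S) = BC(X) / Id(S)`. -/
abbrev BCQuot {k X : Type*} [Field k] (S : Set (BC k X)) : Type _ := (AlgIdeal.span k S).Quotient

/-! ### Gröbner–Shirshov bases -/

section GSB

variable {k X : Type*} [Field k] [LinearOrder (NF X)]

/-- The given linear order on `NF(X)` is a monomial order: it is a well order, and it is
compatible with multiplication from both sides (a product of normal forms is a normal form). -/
structure IsMonomialOrder (X : Type*) [LinearOrder (NF X)] : Prop where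
  wf : WellFoundedLT (NF X)
  mul_lt_mul_right : ∀ μ ν ρ : NF X, μ < ν → μ * ρ < ν * ρ
  mul_lt_mul_left : ∀ μ ν ρ : NF X, μ < ν → ρ * μ < ρ * ν

/-- The leading monomial of an element of `BC(X)`; it is `⊥` exactly for the zero element. -/
def leadMon (f : BC k X) : WithBot (NF X) := f.coeff.support.max

/-- An element of `BC(X)` is monic if it is nonzero and its leading coefficient is `1`. -/
def IsMonic (f : BC k X) : Prop := ∃ μ : NF X, leadMon f = (μ : WithBot (NF X)) ∧ f.coeff μ = 1

/-- The left-normed product `(⋯((f y₁) y₂)⋯) y_q` with letters `y₁, …, y_q`. -/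
def lNormed (f : BC k X) (ys : List X) : BC k X := ys.foldl (fun g y => g * BC.of k y) f

/-- The right-normed product `z₁ (z₂ (⋯ (z_p f)⋯))` with letters `z₁, …, z_p`. -/
def rNormed (zs : List X) (f : BC k X) : BC k X := zs.foldr (fun z g => BC.of k z * g) f

/-- Normal `S`-polynomials: every `s ∈ S`; and, if the leading monomial of `s ∈ S` has length at
least `2`, all `z₁ (⋯ (z_p ((⋯ (s y₁) ⋯) y_q)) ⋯)` with letters `z_i`, `y_j` and `p, q ≥ 0`. -/
inductive IsNormalPoly (S : Set (BC k X)) : BC k X → Prop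
  | base (s : BC k X) (hs : s ∈ S) : IsNormalPoly S s
  | extend (s : BC k X) (hs : s ∈ S) (μ : NF X) (hμ : leadMon s = (μ : WithBot (NF X)))
      (hl : 2 ≤ μ.length) (zs ys : List X) : IsNormalPoly S (rNormed zs (lNormed s ys))

/-- `S` is a Gröbner–Shirshov basis for `BC(X | S)`: it is a monic set, and the leading monomial of
every nonzero element of `Id(S)` is the leading monomial of a normal `S`-polynomial. -/
structure IsGSBasis (S : Set (BC k X)) : Prop where
  monic : ∀ s ∈ S, IsMonic s
  lead : ∀ f ∈ (AlgIdeal.span k S).toSubmodule, f ≠ 0 →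
    ∃ h : BC k X, IsNormalPoly S h ∧ leadMon f = leadMon h

end GSB

/-! ### Gelfand–Kirillov dimension -/

section GKDim

variable {k A : Type*} [Field k] [NonUnitalNonAssocRing A] [Module k A]

/-- The subspace `(V W)` spanned by all products `x y` with `x ∈ V`, `y ∈ W`. -/
def prodSpan (V W : Submodule k A) : Submodule k A :=
  Submodule.span k {a | ∃ x ∈ V, ∃ y ∈ W, a = x * y}

/-- `V¹ = V` and `Vⁿ = ∑_{1 ≤ i ≤ n - 1} (Vⁱ Vⁿ⁻ⁱ)` for `n ≥ 2` (the value at `0` is not used). -/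
def subPow (V : Submodule k A) : ℕ → Submodule k A
  | 0 => ⊥
  | 1 => V
  | n + 2 => ⨆ i : Fin (n + 1), prodSpan (subPow V (i + 1)) (subPow V (n + 1 - i))

/-- `V^{≤ n} = V¹ + V² + ⋯ + Vⁿ`. -/
def subPowLE (V : Submodule k A) (n : ℕ) : Submodule k A := ⨆ i ∈ Finset.Icc 1 n, subPow V i

/-- The Gelfand–Kirillov dimension `sup_V limsup_{n → ∞} log_n dim V^{≤ n}`, where `V` runs through
all finite dimensional subspaces. The convention `log_n 0 = 0` only matters for the zero algebra,
whose dimension is thereby `0`. -/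
def gkDim (k A : Type*) [Field k] [NonUnitalNonAssocRing A] [Module k A] : EReal :=
  ⨆ V : {V : Submodule k A // FiniteDimensional k V},
    Filter.limsup
      (fun n : ℕ => ((Real.logb n (Module.finrank k (subPowLE V.1 n)) : ℝ) : EReal)) Filter.atTop

end GKDim

end Bicomm

end

namespace Bicomm

/-! ### Positive functionals and growth of sets of exponents -/

section Exponents

variable {σ : Type*}

/-! A pair `[u; v]` is the same thing as an exponent vector in ℕ^{2r} whose left and right halves
are both nonzero, and multiplying a pair by letters on either side adds an arbitrary vector. So the
irreducible pairs are the complement of a monomial ideal: their exponents are not above the exponent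
of any leading monomial of S that is itself a pair (`isIrr_iff`). If K ≥ 1 bounds all leading
exponents, membership depends only on the coordinates truncated at K. Hence the number of
irreducible pairs of length at most n grows like n^m, where m is the largest number of coordinates ≥
K in an irreducible vector (`ncard_sum_le_le`, `le_ncard_sum_le`).

The Gröbner–Shirshov property makes irreducible monomials linearly independent modulo Id(S)
(`IsGSBasis.linearIndependent`), so the dimension is at least m. For the upper bound the obstacle is
that the order need not respect length: reducing a monomial may lengthen it. But the finitely many
differences "leading exponent minus other exponent" lie in an additive semigroup without 0, so some
strictly positive weight is positive on all of them (`exists_functional_pos`, `exists_weight`).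
Reduction does not raise this weight, and weight is comparable to length, so lengths grow by at most
a constant factor (`exists_finrank_monSpan_le`). Thus the dimension equals m, with m = 0 if there
are no irreducible pairs (`exists_gkDim_eq`).

What remains is combinatorics. A nonempty S has a leading monomial that is a pair, which forbids all
2r coordinates from being large, so m ≤ 2r - 1 (`card_largeCoords_lt`). If t ≤ r and all leading
monomials are pairs, each can be avoided by setting one of its coordinates to zero, which leaves 2r
- t large ones (`exists_mem_irrExpos`). -/

theorem pos_smul_mem {G : Type*} [AddCommGroup G] {P : G → Prop}
    (hadd : ∀ a b, P a → P b → P (a + b)) {n : ℤ} (hn : 0 < n) {a : G} (ha : P a) :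
    P (n • a) := by
  lift n to ℕ using hn.le
  have hn' : 1 ≤ n := by exact_mod_cast hn
  induction n, hn' using Nat.le_induction with
  | base => simpa using ha
  | succ n h ih =>
    have := hadd _ _ (ih (by exact_mod_cast h)) ha
    simpa [add_smul] using this

/-- A finite set of integer vectors that lies in an additive semigroup without zero lies in an open
half-space. -/
theorem exists_functional_pos {P : (σ → ℤ) → Prop}
    (hadd : ∀ a b, P a → P b → P (a + b)) (h0 : ¬ P 0) (s : Finset σ) :
    ∀ D : Finset (σ → ℤ), (∀ d ∈ D, P d ∧ ∀ i ∉ s, d i = 0) →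
      ∃ w : σ → ℚ, ∀ d ∈ D, 0 < ∑ i ∈ s, w i * d i := by
  classical
  induction s using Finset.induction_on with
  | empty =>
    intro D hD
    refine ⟨0, fun d hd => (h0 ?_).elim⟩
    have : d = 0 := funext fun i => (hD d hd).2 i (by simp)
    exact this ▸ (hD d hd).1
  | insert a s ha ih =>
    intro D hD
    -- Fourier–Motzkin elimination of the coordinate `a`: keep the vectors that vanish there, and
    -- combine each vector positive at `a` with each negative one so that the coordinate cancels.
    -- The combinations have positive integer coefficients, so they stay in the semigroup.
    obtain ⟨w, hw⟩ := ih (D.filter (fun d => d a = 0) ∪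
      Finset.image₂ (fun p q => (-q a) • p + p a • q) (D.filter fun d => 0 < d a)
        (D.filter fun d => d a < 0)) (by
      intro d hd
      rcases Finset.mem_union.1 hd with hd | hd
      · obtain ⟨hd, hda⟩ := Finset.mem_filter.1 hd
        refine ⟨(hD d hd).1, fun i hi => ?_⟩
        by_cases hia : i = a
        · rw [hia, hda]
        · exact (hD d hd).2 i (by simp [hia, hi])
      · obtain ⟨p, hp, q, hq, rfl⟩ := Finset.mem_image₂.1 hd
        obtain ⟨hp, hpa⟩ := Finset.mem_filter.1 hp
        obtain ⟨hq, hqa⟩ := Finset.mem_filter.1 hq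
        refine ⟨hadd _ _ (pos_smul_mem hadd (by omega) (hD p hp).1)
          (pos_smul_mem hadd hpa (hD q hq).1), fun i hi => ?_⟩
        by_cases hia : i = a
        · subst hia; simp; ring
        · simp [(hD p hp).2 i (by simp [hia, hi]), (hD q hq).2 i (by simp [hia, hi])])
    have key : ∀ p ∈ D, ∀ q ∈ D, 0 < p a → q a < 0 →
        0 < (-q a : ℚ) * ∑ i ∈ s, w i * p i + p a * ∑ i ∈ s, w i * q i := by
      intro p hp q hq hpa hqa
      have := hw _ (Finset.mem_union_right _ (Finset.mem_image₂_of_mem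
        (Finset.mem_filter.2 ⟨hp, hpa⟩) (Finset.mem_filter.2 ⟨hq, hqa⟩)))
      rw [Finset.mul_sum, Finset.mul_sum, ← Finset.sum_add_distrib]
      refine this.trans_eq (Finset.sum_congr rfl fun i _ => ?_)
      simp; ring
    -- The weight of `a` must exceed a bound from each vector positive at `a` and stay below one
    -- from each negative vector; `key` says that these bounds are compatible.
    obtain ⟨t, ht1, ht2⟩ := Order.exists_between_finsets
      ((D.filter fun d => 0 < d a).image fun p => -(∑ i ∈ s, w i * p i) / (p a : ℚ))
      ((D.filter fun d => d a < 0).image fun q => (∑ i ∈ s, w i * q i) / (-q a : ℚ)) (by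
        intro x hx y hy
        obtain ⟨p, hp, rfl⟩ := Finset.mem_image.1 hx
        obtain ⟨q, hq, rfl⟩ := Finset.mem_image.1 hy
        obtain ⟨hp, hpa⟩ := Finset.mem_filter.1 hp
        obtain ⟨hq, hqa⟩ := Finset.mem_filter.1 hq
        have hpa' : (0 : ℚ) < p a := by exact_mod_cast hpa
        have hqa' : (q a : ℚ) < 0 := by exact_mod_cast hqa
        rw [div_lt_div_iff₀ hpa' (by linarith)]
        linarith [key p hp q hq hpa hqa])
    refine ⟨Function.update w a t, fun d hd => ?_⟩
    rw [Finset.sum_insert ha, Function.update_self]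
    have e : ∑ i ∈ s, Function.update w a t i * (d i : ℚ) = ∑ i ∈ s, w i * d i :=
      Finset.sum_congr rfl fun i hi => by
        rw [Function.update_of_ne (ne_of_mem_of_not_mem hi ha)]
    rw [e]
    rcases lt_trichotomy (d a) 0 with hda | hda | hda
    · have hda' : (d a : ℚ) < 0 := by exact_mod_cast hda
      have := ht2 _ (Finset.mem_image_of_mem _ (Finset.mem_filter.2 ⟨hd, hda⟩))
      rw [lt_div_iff₀ (by linarith)] at this
      linarith
    · have := hw d (Finset.mem_union_left _ (Finset.mem_filter.2 ⟨hd, hda⟩))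
      simpa [hda] using this
    · have hda' : (0 : ℚ) < d a := by exact_mod_cast hda
      have := ht1 _ (Finset.mem_image_of_mem _ (Finset.mem_filter.2 ⟨hd, hda⟩))
      rw [div_lt_iff₀ hda'] at this
      linarith

variable [Fintype σ]

/-- The coordinates of an exponent vector that are at least `K`. -/
def largeCoords (K : ℕ) (d : σ → ℕ) : Finset σ := Finset.univ.filter fun i => K ≤ d i

theorem mem_largeCoords {K : ℕ} {d : σ → ℕ} {i : σ} : i ∈ largeCoords K d ↔ K ≤ d i := by
  simp [largeCoords]

theorem finite_sum_le (P : Set (σ → ℕ)) (n : ℕ) : {d ∈ P | ∑ i, d i ≤ n}.Finite := by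
  classical
  refine (Finset.finite_toSet (Fintype.piFinset fun _ : σ => Finset.range (n + 1))).subset ?_
  rintro d ⟨-, hd⟩
  simp only [Finset.mem_coe, Fintype.mem_piFinset, Finset.mem_range]
  intro i
  have := Finset.single_le_sum (f := d) (fun _ _ => Nat.zero_le _) (Finset.mem_univ i)
  omega

/-- The vectors are covered by boxes, one for each possible set T of large coordinates: coordinates
in T range up to n, the others up to K. The factor 2^|σ| counts the sets T. -/
theorem ncard_sum_le_le {P : Set (σ → ℕ)} {K m : ℕ} (hm : ∀ d ∈ P, (largeCoords K d).card ≤ m)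
    (n : ℕ) : {d ∈ P | ∑ i, d i ≤ n}.ncard ≤
      2 ^ Fintype.card σ * (K + 1) ^ Fintype.card σ * (n + 1) ^ m := by
  classical
  let box : Finset σ → Finset (σ → ℕ) := fun T =>
    Fintype.piFinset fun i => if i ∈ T then Finset.range (n + 1) else Finset.range (K + 1)
  have hsub : {d ∈ P | ∑ i, d i ≤ n} ⊆
      ((Finset.univ.filter fun T : Finset σ => T.card ≤ m).biUnion box : Finset (σ → ℕ)) := by
    rintro d ⟨hd, hs⟩
    simp only [Finset.coe_biUnion, Set.mem_iUnion, Finset.mem_coe, Finset.mem_filter,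
      Finset.mem_univ, true_and]
    refine ⟨largeCoords K d, hm d hd, ?_⟩
    simp only [box, Fintype.mem_piFinset]
    intro i
    have := Finset.single_le_sum (f := d) (fun _ _ => Nat.zero_le _) (Finset.mem_univ i)
    split_ifs with h
    · simp; omega
    · rw [mem_largeCoords] at h; simp; omega
  have hbox : ∀ T : Finset σ, T.card ≤ m →
      (box T).card ≤ (K + 1) ^ Fintype.card σ * (n + 1) ^ m := by
    intro T hT
    rw [Fintype.card_piFinset]
    calc ∏ i, (if i ∈ T then Finset.range (n + 1) else Finset.range (K + 1)).card
        ≤ ∏ i, ((K + 1) * if i ∈ T then (n + 1) else 1) := by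
          refine Finset.prod_le_prod' fun i _ => ?_
          split_ifs <;> simp
      _ = (K + 1) ^ Fintype.card σ * (n + 1) ^ T.card := by
          rw [Finset.prod_mul_distrib]; simp
      _ ≤ _ := by gcongr; omega
  calc _ ≤ ((Finset.univ.filter fun T : Finset σ => T.card ≤ m).biUnion box).card := by
        rw [← Set.ncard_coe_finset]
        exact Set.ncard_le_ncard hsub (Finset.finite_toSet _)
    _ ≤ ∑ T ∈ Finset.univ.filter (fun T : Finset σ => T.card ≤ m), (box T).card :=
        Finset.card_biUnion_le
    _ ≤ ∑ T ∈ Finset.univ.filter (fun T : Finset σ => T.card ≤ m),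
          (K + 1) ^ Fintype.card σ * (n + 1) ^ m :=
        Finset.sum_le_sum fun T hT => hbox T (Finset.mem_filter.1 hT).2
    _ ≤ _ := by
        rw [Finset.sum_const, smul_eq_mul, mul_assoc]
        gcongr
        exact (Finset.card_le_univ _).trans (by simp)

/-- Moving the large coordinates of `c` freely within [K, K + k] does not change the truncation at
K, so the whole box stays in P. -/
theorem le_ncard_sum_le {P : Set (σ → ℕ)} {K : ℕ}
    (hP : ∀ d d' : σ → ℕ, (∀ i, min (d i) K = min (d' i) K) → d ∈ P → d' ∈ P)
    {c : σ → ℕ} (hc : c ∈ P) {n k : ℕ} (hn : Fintype.card σ * (K + k) + ∑ i, c i ≤ n) :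
    (k + 1) ^ (largeCoords K c).card ≤ {d ∈ P | ∑ i, d i ≤ n}.ncard := by
  classical
  let box : Finset (σ → ℕ) := Fintype.piFinset fun i =>
    if i ∈ largeCoords K c then Finset.Icc K (K + k) else {c i}
  have hcard : box.card = (k + 1) ^ (largeCoords K c).card := by
    rw [Fintype.card_piFinset]
    calc _ = ∏ i, (if i ∈ largeCoords K c then (k + 1) else 1) := by
          refine Finset.prod_congr rfl fun i _ => ?_
          split_ifs
          · simp; omega
          · simp
      _ = _ := by simp
  rw [← hcard, ← Set.ncard_coe_finset]
  refine Set.ncard_le_ncard (fun d hd => ?_) (finite_sum_le P n)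
  simp only [box, Finset.mem_coe, Fintype.mem_piFinset] at hd
  refine ⟨hP c d (fun i => ?_) hc, ?_⟩
  · have := hd i
    split_ifs at this with h
    · rw [mem_largeCoords] at h
      simp at this; omega
    · rw [Finset.mem_singleton.1 this]
  · refine le_trans ?_ hn
    calc ∑ i, d i ≤ ∑ i, ((K + k) + c i) := by
          refine Finset.sum_le_sum fun i _ => ?_
          have := hd i
          split_ifs at this with h <;> simp at this <;> omega
      _ = _ := by rw [Finset.sum_add_distrib]; simp

end Exponents

/-! ### Exponents of normal forms and leading monomials of normal polynomials -/

namespace NF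

variable {X : Type*}

/-- The normal forms that are not letters. -/
def IsPair : NF X → Prop
  | letter _ => False
  | pair _ _ _ _ => True

theorem isPair_mul (μ ν : NF X) : (μ * ν).IsPair := by
  cases μ <;> cases ν <;> trivial

theorem isPair_of_two_le_length {μ : NF X} (h : 2 ≤ μ.length) : μ.IsPair := by
  cases μ with
  | letter x => simp [length] at h
  | pair u v hu hv => trivial

theorem IsPair.two_le_length {μ : NF X} (h : μ.IsPair) : 2 ≤ μ.length := by
  cases μ with
  | letter x => exact h.elim
  | pair u v hu hv =>
    have := Multiset.card_pos.2 hu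
    have := Multiset.card_pos.2 hv
    simp only [length]; omega

theorem length_mul (μ ν : NF X) : (μ * ν).length = μ.length + ν.length := by
  cases μ <;> cases ν <;>
    simp [length, letter_mul_letter, letter_mul_pair, pair_mul_letter, pair_mul_pair] <;> omega

open Classical in
/-- The exponent vector of `[u; v]`; a letter is given the exponent it contributes to
`[x; y]`, namely that of `x` on the left. -/
noncomputable def expo : NF X → (X ⊕ X → ℕ)
  | letter x => Pi.single (Sum.inl x) 1
  | pair u v _ _ => Sum.elim (fun x => u.count x) (fun x => v.count x)

open Classical in
/-- The exponent vectors that a normal form can contribute to a product. -/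
noncomputable def expos : NF X → Finset (X ⊕ X → ℕ)
  | letter x => {Pi.single (Sum.inl x) 1, Pi.single (Sum.inr x) 1}
  | pair u v hu hv => {expo (pair u v hu hv)}

theorem expo_mem_expos (μ : NF X) : μ.expo ∈ μ.expos := by
  cases μ <;> simp [expos, expo]

theorem mem_expos_of_isPair {μ : NF X} (h : μ.IsPair) {e : X ⊕ X → ℕ} :
    e ∈ μ.expos ↔ e = μ.expo := by
  cases μ with
  | letter x => exact h.elim
  | pair u v hu hv => simp [expos]

open Classical in
theorem expo_mul_letter (μ : NF X) (y : X) :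
    (μ * letter y).expo = μ.expo + Pi.single (Sum.inr y) 1 := by
  cases μ with
  | letter x =>
    ext (i | i) <;> simp [letter_mul_letter, expo, Pi.single_apply, Multiset.count_singleton]
  | pair u v hu hv =>
    ext (i | i) <;> simp [pair_mul_letter, expo, Pi.single_apply, Multiset.count_cons]

open Classical in
theorem expo_letter_mul {μ : NF X} (h : μ.IsPair) (z : X) :
    (letter z * μ).expo = μ.expo + Pi.single (Sum.inl z) 1 := by
  cases μ with
  | letter x => exact h.elim
  | pair u v hu hv =>
    ext (i | i) <;> simp [letter_mul_pair, expo, Pi.single_apply, Multiset.count_cons]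

open Classical in
theorem expo_letter_mul_letter (z x : X) :
    (letter z * letter x : NF X).expo = Pi.single (Sum.inr x) 1 + Pi.single (Sum.inl z) 1 := by
  ext (i | i) <;> simp [letter_mul_letter, expo, Pi.single_apply, Multiset.count_singleton]

theorem expo_mul {μ ν : NF X} (hμ : μ.IsPair) (hν : ν.IsPair) :
    (μ * ν).expo = μ.expo + ν.expo := by
  cases μ with
  | letter x => exact hμ.elim
  | pair u v hu hv =>
    cases ν with
    | letter x => exact hν.elim
    | pair u' v' hu' hv' => ext (i | i) <;> simp [pair_mul_pair, expo]

theorem eq_of_expo_eq {μ ν : NF X} (hμ : μ.IsPair) (hν : ν.IsPair) (h : μ.expo = ν.expo) :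
    μ = ν := by
  classical
  cases μ with
  | letter x => exact hμ.elim
  | pair u v hu hv =>
    cases ν with
    | letter x => exact hν.elim
    | pair u' v' hu' hv' =>
      have h1 : u = u' := Multiset.ext.2 fun x => by simpa [expo] using congrFun h (Sum.inl x)
      have h2 : v = v' := Multiset.ext.2 fun x => by simpa [expo] using congrFun h (Sum.inr x)
      subst h1 h2
      rfl

theorem length_eq_sum_expo [Fintype X] {μ : NF X} (hμ : μ.IsPair) :
    μ.length = ∑ i, μ.expo i := by
  classical
  cases μ with
  | letter x => exact hμ.elim
  | pair u v hu hv => simp [length, expo, Fintype.sum_sum_type]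

theorem exists_expo_inl_ne_zero {μ : NF X} (hμ : μ.IsPair) : ∃ x, μ.expo (Sum.inl x) ≠ 0 := by
  classical
  cases μ with
  | letter x => exact hμ.elim
  | pair u v hu hv =>
    obtain ⟨x, hx⟩ := Multiset.exists_mem_of_ne_zero hu
    exact ⟨x, by simpa [expo] using hx⟩

theorem exists_expo_inr_ne_zero {μ : NF X} (hμ : μ.IsPair) : ∃ x, μ.expo (Sum.inr x) ≠ 0 := by
  classical
  cases μ with
  | letter x => exact hμ.elim
  | pair u v hu hv =>
    obtain ⟨x, hx⟩ := Multiset.exists_mem_of_ne_zero hv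
    exact ⟨x, by simpa [expo] using hx⟩

theorem exists_multiset_count [Fintype X] (f : X → ℕ) :
    ∃ u : Multiset X, ∀ x, (open Classical in u.count x) = f x := by
  classical
  refine ⟨Finsupp.toMultiset (Finsupp.equivFunOnFinite.symm f), fun x => ?_⟩
  rw [Finsupp.count_toMultiset]; rfl

theorem exists_isPair_expo_eq [Fintype X] {d : X ⊕ X → ℕ} (h1 : ∃ x, d (Sum.inl x) ≠ 0)
    (h2 : ∃ x, d (Sum.inr x) ≠ 0) : ∃ μ : NF X, μ.IsPair ∧ μ.expo = d := by
  classical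
  obtain ⟨u, hu⟩ := exists_multiset_count fun x => d (Sum.inl x)
  obtain ⟨v, hv⟩ := exists_multiset_count fun x => d (Sum.inr x)
  refine ⟨pair u v ?_ ?_, trivial, ?_⟩
  · rintro rfl
    obtain ⟨x, hx⟩ := h1
    exact hx (by rw [← hu]; simp)
  · rintro rfl
    obtain ⟨x, hx⟩ := h2
    exact hx (by rw [← hv]; simp)
  · ext (i | i)
    · exact hu i
    · exact hv i

/-- The normal form of `z₁ (⋯ (z_p ((⋯ (ν y₁) ⋯) y_q)) ⋯)`. -/
def shift (zs ys : List X) (ν : NF X) : NF X :=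
  zs.foldr (fun z μ => letter z * μ) (ys.foldl (fun μ y => μ * letter y) ν)

open Classical in
/-- The exponent vector that `shift` adds. -/
noncomputable def shiftExpo (zs ys : List X) : X ⊕ X → ℕ := Sum.elim (fun x => zs.count x) (fun x => ys.count x)

theorem expo_foldl (ys : List X) (ν : NF X) :
    (ys.foldl (fun μ y => μ * letter y) ν).expo = ν.expo + shiftExpo [] ys := by
  classical
  induction ys generalizing ν with
  | nil => ext (i | i) <;> simp [shiftExpo]
  | cons y ys ih =>
    rw [List.foldl_cons, ih, expo_mul_letter]
    ext (i | i) <;> simp [shiftExpo, List.count_cons, Pi.single_apply]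
    split_ifs <;> first | omega | simp_all

theorem isPair_foldl {ν : NF X} (ys : List X) (h : ν.IsPair ∨ ys ≠ []) :
    (ys.foldl (fun μ y => μ * letter y) ν).IsPair := by
  induction ys generalizing ν with
  | nil => simpa using h
  | cons y ys ih => exact ih (Or.inl (isPair_mul _ _))

theorem isPair_foldr {ν : NF X} (zs : List X) (h : ν.IsPair) :
    (zs.foldr (fun z μ => letter z * μ) ν).IsPair := by
  cases zs with
  | nil => exact h
  | cons z zs => exact isPair_mul _ _

theorem expo_foldr {ν : NF X} (h : ν.IsPair) (zs : List X) :
    (zs.foldr (fun z μ => letter z * μ) ν).expo = ν.expo + shiftExpo zs [] := by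
  classical
  induction zs with
  | nil => ext (i | i) <;> simp [shiftExpo]
  | cons z zs ih =>
    rw [List.foldr_cons, expo_letter_mul (isPair_foldr zs h), ih]
    ext (i | i) <;> simp [shiftExpo, List.count_cons, Pi.single_apply]
    split_ifs <;> first | omega | simp_all

theorem isPair_shift {ν : NF X} (h : ν.IsPair) (zs ys : List X) : (shift zs ys ν).IsPair :=
  isPair_foldr zs (isPair_foldl ys (Or.inl h))

theorem shiftExpo_add (zs ys : List X) :
    shiftExpo [] ys + shiftExpo zs [] = shiftExpo zs ys := by
  ext (i | i) <;> simp [shiftExpo]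

theorem expo_shift {ν : NF X} (zs ys : List X) (h : ν.IsPair ∨ ys ≠ []) :
    (shift zs ys ν).expo = ν.expo + shiftExpo zs ys := by
  rw [shift, expo_foldr (isPair_foldl ys h), expo_foldl, add_assoc, shiftExpo_add]

/-- Where a letter ends up depends on its first multiplication: a right factor puts it in the left
word, while with left factors only it lands in the right word. This is why `expos` holds two vectors
for a letter. -/
theorem exists_expos_shift {ν : NF X} {zs ys : List X} (h : (shift zs ys ν).IsPair) :
    ∃ e ∈ ν.expos, (shift zs ys ν).expo = e + shiftExpo zs ys := by
  classical
  by_cases hν : ν.IsPair ∨ ys ≠ []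
  · exact ⟨_, expo_mem_expos ν, expo_shift zs ys hν⟩
  · push Not at hν
    obtain ⟨hν, rfl⟩ := hν
    cases ν with
    | pair u v hu hv => exact (hν trivial).elim
    | letter x =>
      refine ⟨Pi.single (Sum.inr x) 1, by simp [expos], ?_⟩
      rcases List.eq_nil_or_concat zs with rfl | ⟨zs, z, rfl⟩
      · exact h.elim
      · simp only [shift, List.foldl_nil, List.concat_eq_append, List.foldr_append,
          List.foldr_cons, List.foldr_nil]
        rw [expo_foldr (isPair_mul _ _), expo_letter_mul_letter]
        ext (i | i) <;> simp [shiftExpo, Pi.single_apply, List.count_append, List.count_cons]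
        split_ifs <;> first | omega | simp_all

theorem exists_shift_eq [Fintype X] {μ ν : NF X} (hμ : μ.IsPair) (hν : ν.IsPair)
    (h : μ.expo ≤ ν.expo) : ∃ zs ys, shift zs ys μ = ν := by
  classical
  obtain ⟨u, hu⟩ := exists_multiset_count fun x => ν.expo (Sum.inl x) - μ.expo (Sum.inl x)
  obtain ⟨v, hv⟩ := exists_multiset_count fun x => ν.expo (Sum.inr x) - μ.expo (Sum.inr x)
  refine ⟨u.toList, v.toList, eq_of_expo_eq (isPair_shift hμ _ _) hν ?_⟩
  rw [expo_shift _ _ (Or.inl hμ)]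
  ext (i | i)
  · have e : u.toList.count i = u.count i := by rw [← Multiset.coe_count, Multiset.coe_toList]
    have hle : μ.expo (Sum.inl i) ≤ ν.expo (Sum.inl i) := h _
    have h2 := hu i
    simp [shiftExpo]
    rw [e]
    have : u.count i = ν.expo (Sum.inl i) - μ.expo (Sum.inl i) := by convert h2
    omega
  · have e : v.toList.count i = v.count i := by rw [← Multiset.coe_count, Multiset.coe_toList]
    have hle : μ.expo (Sum.inr i) ≤ ν.expo (Sum.inr i) := h _
    have h2 := hv i
    simp [shiftExpo]
    rw [e]
    have : v.count i = ν.expo (Sum.inr i) - μ.expo (Sum.inr i) := by convert h2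
    omega

/-! ### Monomial orders seen through exponent differences -/

section Order

variable [LinearOrder (NF X)]

theorem letter_mul_strictMono (hord : IsMonomialOrder X) (z : X) :
    StrictMono fun μ : NF X => letter z * μ := fun _ _ h => hord.mul_lt_mul_left _ _ _ h

theorem mul_letter_strictMono (hord : IsMonomialOrder X) (y : X) :
    StrictMono fun μ : NF X => μ * letter y := fun _ _ h => hord.mul_lt_mul_right _ _ _ h

/-- If z μ < μ, then multiplying by z repeatedly would give an infinite descending chain. -/
theorem not_letter_mul_lt (hord : IsMonomialOrder X) (z : X) (μ : NF X) :
    ¬ letter z * μ < μ := by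
  induction μ using hord.wf.induction with
  | ind μ ih => exact fun h => ih _ h (hord.mul_lt_mul_left _ _ _ h)

theorem not_mul_letter_lt (hord : IsMonomialOrder X) (y : X) (μ : NF X) :
    ¬ μ * letter y < μ := by
  induction μ using hord.wf.induction with
  | ind μ ih => exact fun h => ih _ h (hord.mul_lt_mul_right _ _ _ h)

/-- The differences of exponent vectors of increasing pairs. -/
def PosDiff (d : X ⊕ X → ℤ) : Prop :=
  ∃ p q : NF X, p.IsPair ∧ q.IsPair ∧ p < q ∧ ∀ i, (q.expo i : ℤ) - p.expo i = d i

/-- From p < q and p' < q' follows p p' < q p' < q q', and exponents of pairs add under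
multiplication. -/
theorem PosDiff.add (hord : IsMonomialOrder X) {d e : X ⊕ X → ℤ} (hd : PosDiff d)
    (he : PosDiff e) : PosDiff (d + e) := by
  obtain ⟨p, q, hp, hq, hpq, h⟩ := hd
  obtain ⟨p', q', hp', hq', hpq', h'⟩ := he
  refine ⟨p * p', q * q', isPair_mul _ _, isPair_mul _ _,
    (hord.mul_lt_mul_right _ _ _ hpq).trans (hord.mul_lt_mul_left _ _ _ hpq'), fun i => ?_⟩
  rw [expo_mul hp hp', expo_mul hq hq']
  have := h i
  have := h' i
  simp only [Pi.add_apply]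
  push_cast
  omega

theorem not_posDiff_zero : ¬ PosDiff (0 : X ⊕ X → ℤ) := by
  rintro ⟨p, q, hp, hq, hpq, h⟩
  refine hpq.ne (eq_of_expo_eq hp hq (funext fun i => ?_))
  have := h i
  simp only [Pi.zero_apply] at this
  omega

-- A further letter never decreases a monomial, and here it changes the exponent, so the increase is
-- strict. This is what will force the weights to be positive.
open Classical in
theorem posDiff_single (hord : IsMonomialOrder X) (i : X ⊕ X) :
    PosDiff (Pi.single i 1) := by
  rcases i with x | x
  · have e := expo_letter_mul (isPair_mul (letter x) (letter x)) x
    refine ⟨letter x * letter x, letter x * (letter x * letter x), isPair_mul _ _,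
      isPair_mul _ _, (not_lt.1 (not_letter_mul_lt hord _ _)).lt_of_ne fun h => ?_, fun i => ?_⟩
    · rw [← h] at e
      simpa using congrFun e (Sum.inl x)
    · rw [e]
      simp [Pi.single_apply]
  · have e := expo_mul_letter (letter x * letter x) x
    refine ⟨letter x * letter x, (letter x * letter x) * letter x, isPair_mul _ _,
      isPair_mul _ _, (not_lt.1 (not_mul_letter_lt hord _ _)).lt_of_ne fun h => ?_, fun i => ?_⟩
    · rw [← h] at e
      simpa using congrFun e (Sum.inr x)
    · rw [e]
      simp [Pi.single_apply]

/-- For a letter ν = x, multiply the inequality by x on the right or on the left to get two pairs.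
The added factor cancels in the difference, and the side chosen decides which of the two exponents
of x remains. -/
theorem posDiff_of_lt (hord : IsMonomialOrder X) {ν μ : NF X} (hμ : μ.IsPair) (h : ν < μ)
    {e : X ⊕ X → ℕ} (he : e ∈ ν.expos) : PosDiff fun i => (μ.expo i : ℤ) - e i := by
  classical
  cases ν with
  | pair u v hu hv =>
    rw [mem_expos_of_isPair (show (pair u v hu hv).IsPair from trivial)] at he
    exact ⟨pair u v hu hv, μ, trivial, hμ, h, fun i => by rw [he]⟩
  | letter x =>
    simp only [expos, Finset.mem_insert, Finset.mem_singleton] at he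
    rcases he with rfl | rfl
    · refine ⟨_, _, isPair_mul _ _, isPair_mul _ _, hord.mul_lt_mul_right _ _ (letter x) h,
        fun i => ?_⟩
      rw [expo_mul_letter, expo_mul_letter]
      simp [expo]
    · refine ⟨_, _, isPair_mul _ _, isPair_mul _ _, hord.mul_lt_mul_left _ _ (letter x) h,
        fun i => ?_⟩
      rw [expo_letter_mul hμ, expo_letter_mul_letter]
      simp

theorem shift_strictMono (hord : IsMonomialOrder X) (zs ys : List X) :
    StrictMono (shift zs ys) := by
  have h1 : StrictMono fun ν : NF X => ys.foldl (fun μ y => μ * letter y) ν := by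
    induction ys with
    | nil => exact strictMono_id
    | cons y ys ih => exact ih.comp (mul_letter_strictMono hord y)
  have h2 : StrictMono fun ν : NF X => zs.foldr (fun z μ => letter z * μ) ν := by
    induction zs with
    | nil => exact strictMono_id
    | cons z zs ih => exact (letter_mul_strictMono hord z).comp ih
  exact h2.comp h1

end Order

end NF

section Span

variable {k X : Type*} [Field k]

theorem subset_span (S : Set (BC k X)) : S ⊆ (AlgIdeal.span k S).toSubmodule := by
  intro s hs
  refine (Submodule.mem_sInf).2 ?_
  rintro _ ⟨I, rfl, hI⟩
  exact hI hs

theorem rNormed_lNormed_mem (I : AlgIdeal k (BC k X)) {f : BC k X} (hf : f ∈ I.toSubmodule)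
    (zs ys : List X) : rNormed zs (lNormed f ys) ∈ I.toSubmodule := by
  have h1 : lNormed f ys ∈ I.toSubmodule := by
    induction ys generalizing f with
    | nil => exact hf
    | cons y ys ih => exact ih (I.mul_mem_right _ _ hf)
  induction zs with
  | nil => exact h1
  | cons z zs ih => exact I.mul_mem_left _ _ ih

end Span

/-! ### Leading monomials under multiplication by letters -/

section Leading

variable {k X : Type*} [Field k] [LinearOrder (NF X)]

theorem leadMon_eq_coe_iff {f : BC k X} {μ : NF X} :
    leadMon f = μ ↔ μ ∈ f.coeff.support ∧ ∀ ν ∈ f.coeff.support, ν ≤ μ := by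
  constructor
  · intro h
    exact ⟨Finset.mem_of_max h, fun ν hν => Finset.le_max_of_eq hν h⟩
  · rintro ⟨h1, h2⟩
    refine le_antisymm (Finset.max_le fun ν hν => ?_) (Finset.le_max h1)
    exact WithBot.coe_le_coe.2 (h2 ν hν)

theorem exists_leadMon_eq {f : BC k X} (hf : f ≠ 0) : ∃ μ : NF X, leadMon f = μ := by
  refine Finset.max_of_nonempty ?_
  rw [Finsupp.support_nonempty_iff]
  simpa using hf

theorem support_of_mul (hord : IsMonomialOrder X) (z : X) (f : BC k X) :
    (BC.of k z * f).coeff.support = f.coeff.support.image (NF.letter z * ·) := by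
  rw [BC.of, MonoidAlgebra.support_coeff_single_mul_eq_image f (by simp)
    fun _ _ h => (NF.letter_mul_strictMono hord z).injective h]

theorem support_mul_of (hord : IsMonomialOrder X) (y : X) (f : BC k X) :
    (f * BC.of k y).coeff.support = f.coeff.support.image (· * NF.letter y) := by
  rw [BC.of, MonoidAlgebra.support_coeff_mul_single_eq_image f (by simp)
    fun _ _ h => (NF.mul_letter_strictMono hord y).injective h]

theorem coeff_of_mul (hord : IsMonomialOrder X) (z : X) (f : BC k X) (μ : NF X) :
    (BC.of k z * f).coeff (NF.letter z * μ) = f.coeff μ := by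
  rw [BC.of, MonoidAlgebra.coeff_single_mul_eq_mul_coeff μ, one_mul]
  exact fun _ _ => (NF.letter_mul_strictMono hord z).injective.eq_iff

theorem coeff_mul_of (hord : IsMonomialOrder X) (y : X) (f : BC k X) (μ : NF X) :
    (f * BC.of k y).coeff (μ * NF.letter y) = f.coeff μ := by
  rw [BC.of, MonoidAlgebra.coeff_mul_single_eq_coeff_mul μ, mul_one]
  exact fun _ _ => (NF.mul_letter_strictMono hord y).injective.eq_iff

theorem support_rNormed_lNormed (hord : IsMonomialOrder X) (zs ys : List X) (f : BC k X) :
    (rNormed zs (lNormed f ys)).coeff.support = f.coeff.support.image (NF.shift zs ys) := by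
  have h1 : (lNormed f ys).coeff.support =
      f.coeff.support.image (fun ν => ys.foldl (fun μ y => μ * NF.letter y) ν) := by
    induction ys generalizing f with
    | nil => simp [lNormed]
    | cons y ys ih =>
      change (lNormed (f * BC.of k y) ys).coeff.support = _
      rw [ih, support_mul_of hord, Finset.image_image]
      rfl
  have h2 : ∀ g : BC k X, (rNormed zs g).coeff.support =
      g.coeff.support.image (fun ν => zs.foldr (fun z μ => NF.letter z * μ) ν) := by
    intro g
    induction zs with
    | nil => simp [rNormed]
    | cons z zs ih =>
      change (BC.of k z * rNormed zs g).coeff.support = _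
      rw [support_of_mul hord, ih, Finset.image_image]
      rfl
  rw [h2, h1, Finset.image_image]
  rfl

theorem coeff_rNormed_lNormed (hord : IsMonomialOrder X) (zs ys : List X) (f : BC k X)
    (μ : NF X) : (rNormed zs (lNormed f ys)).coeff (NF.shift zs ys μ) = f.coeff μ := by
  have h1 : (lNormed f ys).coeff (ys.foldl (fun μ y => μ * NF.letter y) μ) = f.coeff μ := by
    induction ys generalizing f μ with
    | nil => rfl
    | cons y ys ih => exact (ih _ _).trans (coeff_mul_of hord y f μ)
  have h2 : ∀ (g : BC k X) (ν : NF X),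
      (rNormed zs g).coeff (zs.foldr (fun z μ => NF.letter z * μ) ν) = g.coeff ν := by
    intro g ν
    induction zs with
    | nil => rfl
    | cons z zs ih => exact (coeff_of_mul hord z _ _).trans ih
  exact (h2 _ _).trans h1

theorem leadMon_rNormed_lNormed (hord : IsMonomialOrder X) (zs ys : List X) {f : BC k X}
    {μ : NF X} (h : leadMon f = μ) :
    leadMon (rNormed zs (lNormed f ys)) = (NF.shift zs ys μ : WithBot (NF X)) := by
  rw [leadMon_eq_coe_iff] at h ⊢
  rw [support_rNormed_lNormed hord]
  refine ⟨Finset.mem_image_of_mem _ h.1, fun ν hν => ?_⟩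
  obtain ⟨ρ, hρ, rfl⟩ := Finset.mem_image.1 hν
  exact (NF.shift_strictMono hord zs ys).monotone (h.2 ρ hρ)

/-- A normal polynomial whose leading monomial is not a letter comes from an element of `S` with the
same property. -/
theorem IsNormalPoly.exists_eq (hord : IsMonomialOrder X) {S : Set (BC k X)} {h : BC k X}
    (hh : IsNormalPoly S h) {μ : NF X} (hμ : leadMon h = μ) (hp : μ.IsPair) :
    ∃ s ∈ S, ∃ M : NF X, leadMon s = M ∧ M.IsPair ∧ ∃ zs ys : List X,
      h = rNormed zs (lNormed s ys) ∧ μ = NF.shift zs ys M := by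
  cases hh with
  | base _ hs => exact ⟨h, hs, μ, hμ, hp, [], [], rfl, rfl⟩
  | extend s hs M hM hl zs ys =>
    refine ⟨s, hs, M, hM, NF.isPair_of_two_le_length hl, zs, ys, rfl, ?_⟩
    rw [leadMon_rNormed_lNormed hord zs ys hM] at hμ
    exact (WithBot.coe_injective hμ).symm

theorem IsGSBasis.exists_isPair_leadMon [Nonempty X] (hord : IsMonomialOrder X)
    {S : Set (BC k X)} (hS : IsGSBasis S) (hne : S.Nonempty) :
    ∃ s ∈ S, ∃ M : NF X, leadMon s = M ∧ M.IsPair := by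
  obtain ⟨s, hs⟩ := hne
  obtain ⟨μ, hμ, -⟩ := hS.monic s hs
  let y : X := Classical.arbitrary X
  have hlead := leadMon_rNormed_lNormed hord [] [y] hμ
  -- The product s y lies in the ideal and its leading monomial is a pair even if that of s is a
  -- letter. Letters are not extended in normal polynomials, so some element of S must itself lead
  -- with a pair.
  obtain ⟨h, hh, hh'⟩ := hS.lead _ (rNormed_lNormed_mem _ (subset_span S hs) [] [y]) (by
    intro h0
    rw [h0] at hlead
    simpa using (leadMon_eq_coe_iff.1 hlead).1)
  obtain ⟨s', hs', M, hM, hp, -⟩ :=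
    hh.exists_eq hord (hh'.symm.trans hlead) (NF.isPair_mul _ _)
  exact ⟨s', hs', M, hM, hp⟩

end Leading

/-! ### Growth and Gelfand–Kirillov dimension -/

section Growth

open Filter Topology

/-- A constant factor is invisible to the growth exponent, since log C / log n tends to 0. -/
theorem tendsto_logb_natCast_add (C a : ℝ) :
    Tendsto (fun n : ℕ => ((Real.logb n C + a : ℝ) : EReal)) atTop (𝓝 (a : EReal)) := by
  refine (continuous_coe_real_ereal.tendsto a).comp ?_
  have h : Tendsto (fun n : ℕ => Real.log C / Real.log n) atTop (𝓝 0) :=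
    (Real.tendsto_log_atTop.comp tendsto_natCast_atTop_atTop).const_div_atTop _
  simpa [Real.logb] using h.add_const a

variable {k A : Type*} [Field k] [NonUnitalNonAssocRing A] [Module k A]

theorem gkDim_le {m : ℕ} (h : ∀ V : Submodule k A, FiniteDimensional k V →
    ∃ C : ℝ, 1 ≤ C ∧ ∀ n : ℕ, 1 ≤ n → (Module.finrank k (subPowLE V n) : ℝ) ≤ C * n ^ m) :
    gkDim k A ≤ m := by
  refine iSup_le fun ⟨V, hV⟩ => ?_
  obtain ⟨C, hC, hn⟩ := h V hV
  have hlim := (tendsto_logb_natCast_add C m).limsup_eq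
  rw [show ((m : ℕ) : EReal) = ((m : ℝ) : EReal) by norm_cast, ← hlim]
  refine limsup_le_limsup ?_
  filter_upwards [eventually_ge_atTop 2] with n h2
  have h2' : (1 : ℝ) < n := by exact_mod_cast h2
  rw [EReal.coe_le_coe_iff]
  have hpow : Real.logb n ((n : ℝ) ^ m) = m := by
    rw [← Real.rpow_natCast, Real.logb_rpow (by linarith) (by linarith)]
  have hsplit : Real.logb n C + m = Real.logb n (C * n ^ m) := by
    rw [Real.logb_mul (by positivity) (by positivity), hpow]
  -- In dimension 0 the logarithm takes its default value 0, and `1 ≤ C` keeps the right-hand side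
  -- nonnegative.
  rcases Nat.eq_zero_or_pos (Module.finrank k (subPowLE V n)) with h0 | h0
  · rw [h0, Nat.cast_zero, Real.logb_zero]
    have := Real.logb_nonneg h2' hC
    positivity
  · rw [hsplit]
    exact Real.logb_le_logb_of_le h2' (by exact_mod_cast h0) (hn n (by omega))

theorem le_gkDim {m : ℕ} {V : Submodule k A} (hV : FiniteDimensional k V) {c : ℝ} (hc : 0 < c)
    (h : ∀ᶠ n : ℕ in atTop, c * (n : ℝ) ^ m ≤ Module.finrank k (subPowLE V n)) :
    (m : EReal) ≤ gkDim k A := by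
  refine le_trans ?_ (le_iSup _ (⟨V, hV⟩ : {V : Submodule k A // FiniteDimensional k V}))
  have hlim := (tendsto_logb_natCast_add c m).limsup_eq
  rw [show ((m : ℕ) : EReal) = ((m : ℝ) : EReal) by norm_cast, ← hlim]
  refine limsup_le_limsup ?_
  filter_upwards [eventually_ge_atTop 2, h] with n h2 hn
  have h2' : (1 : ℝ) < n := by exact_mod_cast h2
  rw [EReal.coe_le_coe_iff]
  have hpow : Real.logb n ((n : ℝ) ^ m) = m := by
    rw [← Real.rpow_natCast, Real.logb_rpow (by linarith) (by linarith)]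
  rw [← hpow, ← Real.logb_mul (by positivity) (by positivity)]
  exact Real.logb_le_logb_of_le h2' (by positivity) hn

theorem gkDim_nonneg : 0 ≤ gkDim k A := by
  refine le_trans ?_ (le_iSup _
    (⟨⊥, inferInstance⟩ : {V : Submodule k A // FiniteDimensional k V}))
  have hlim : limsup (fun _ : ℕ => (0 : EReal)) atTop = 0 := limsup_const 0
  rw [← hlim]
  refine limsup_le_limsup ?_
  filter_upwards [eventually_ge_atTop 2] with n h2
  rw [← EReal.coe_zero, EReal.coe_le_coe_iff]
  rcases Nat.eq_zero_or_pos (Module.finrank k (subPowLE (⊥ : Submodule k A) n)) with h0 | h0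
  · rw [h0]; simp
  · exact Real.logb_nonneg (by exact_mod_cast h2) (by exact_mod_cast h0)

end Growth

/-! ### Spans of monomials in the quotient -/

section MonSpan

variable {k X : Type*} [Field k]

/-- The subspace of `BC(X) / I` spanned by the images of a set of normal forms. -/
noncomputable def monSpan (I : AlgIdeal k (BC k X)) (T : Set (NF X)) : Submodule k I.Quotient :=
  Submodule.span k ((fun μ => I.proj (MonoidAlgebra.single μ 1)) '' T)

variable (I : AlgIdeal k (BC k X))

theorem proj_single_mem_monSpan {T : Set (NF X)} {μ : NF X} (h : μ ∈ T) :
    I.proj (MonoidAlgebra.single μ 1) ∈ monSpan I T :=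
  Submodule.subset_span ⟨μ, h, rfl⟩

theorem monSpan_mono {T T' : Set (NF X)} (h : T ⊆ T') : monSpan I T ≤ monSpan I T' :=
  Submodule.span_mono (Set.image_mono h)

theorem proj_mem_of_support {U : Submodule k I.Quotient} {f : BC k X}
    (h : ∀ μ ∈ f.coeff.support, I.proj (MonoidAlgebra.single μ 1) ∈ U) : I.proj f ∈ U := by
  rw [← MonoidAlgebra.sum_coeff_single f, Finsupp.sum, map_sum]
  refine Submodule.sum_mem _ fun μ hμ => ?_
  have e : (MonoidAlgebra.single μ (f.coeff μ) : BC k X) =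
      f.coeff μ • MonoidAlgebra.single μ 1 := by simp
  rw [e, map_smul]
  exact U.smul_mem _ (h μ hμ)

theorem finiteDimensional_monSpan {T : Set (NF X)} (hT : T.Finite) :
    FiniteDimensional k (monSpan I T) :=
  FiniteDimensional.span_of_finite k (hT.image _)

theorem finrank_monSpan_le {T : Set (NF X)} (hT : T.Finite) :
    Module.finrank k (monSpan I T) ≤ T.ncard := by
  classical
  have hfin := hT.image fun μ => I.proj (MonoidAlgebra.single μ (1 : k))
  refine le_trans ?_ (Set.ncard_image_le hT (f := fun μ => I.proj (MonoidAlgebra.single μ (1 : k))))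
  rw [Set.ncard_eq_toFinset_card _ hfin]
  have := finrank_span_finset_le_card (R := k) hfin.toFinset
  rwa [Set.Finite.coe_toFinset] at this

theorem prodSpan_monSpan_le {T T' U : Set (NF X)} (h : ∀ μ ∈ T, ∀ ν ∈ T', μ * ν ∈ U) :
    prodSpan (monSpan I T) (monSpan I T') ≤ monSpan I U := by
  refine Submodule.span_le.2 ?_
  rintro _ ⟨x, hx, y, hy, rfl⟩
  induction hx using Submodule.span_induction with
  | zero => rw [zero_mul]; exact Submodule.zero_mem _
  | add a b _ _ ha hb => rw [add_mul]; exact Submodule.add_mem _ ha hb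
  | smul c a _ ha => rw [smul_mul_assoc]; exact Submodule.smul_mem _ _ ha
  | mem x hx =>
    obtain ⟨μ, hμ, rfl⟩ := hx
    induction hy using Submodule.span_induction with
    | zero => rw [mul_zero]; exact Submodule.zero_mem _
    | add a b _ _ ha hb => rw [mul_add]; exact Submodule.add_mem _ ha hb
    | smul c a _ ha => rw [mul_smul_comm]; exact Submodule.smul_mem _ _ ha
    | mem y hy =>
      obtain ⟨ν, hν, rfl⟩ := hy
      change I.proj (MonoidAlgebra.single μ 1) * I.proj (MonoidAlgebra.single ν 1) ∈ _
      rw [← AlgIdeal.proj_mul, MonoidAlgebra.single_mul_single, one_mul]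
      exact proj_single_mem_monSpan I (h μ hμ ν hν)

theorem prodSpan_mono {A : Type*} [NonUnitalNonAssocRing A] [Module k A]
    {V V' W W' : Submodule k A} (h : V ≤ V') (h' : W ≤ W') : prodSpan V W ≤ prodSpan V' W' := by
  refine Submodule.span_mono ?_
  rintro _ ⟨x, hx, y, hy, rfl⟩
  exact ⟨x, h hx, y, h' hy, rfl⟩

/-- Length is additive on products of normal forms, so n factors of length at most d give length at
most d n. -/
theorem subPow_le_monSpan {V : Submodule k I.Quotient} {d : ℕ}
    (hV : V ≤ monSpan I {μ | μ.length ≤ d}) (n : ℕ) :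
    subPow V n ≤ monSpan I {μ | μ.length ≤ d * n} := by
  induction n using Nat.strong_induction_on with
  | _ n ih =>
    match n, ih with
    | 0, _ => rw [subPow]; exact bot_le
    | 1, _ => rw [subPow]; simpa using hV
    | n + 2, ih =>
      rw [subPow]
      refine iSup_le fun i => ?_
      have hi := i.2
      refine (prodSpan_mono (ih (i + 1) (by omega)) (ih (n + 1 - i) (by omega))).trans
        (prodSpan_monSpan_le I fun μ hμ ν hν => ?_)
      simp only [Set.mem_ofPred_eq] at hμ hν ⊢
      have e : d * (n + 2) = d * (i + 1) + d * (n + 1 - i) := by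
        rw [← mul_add]; congr 1; omega
      rw [NF.length_mul, e]
      exact add_le_add hμ hν

theorem subPowLE_le_monSpan {V : Submodule k I.Quotient} {d : ℕ}
    (hV : V ≤ monSpan I {μ | μ.length ≤ d}) (n : ℕ) :
    subPowLE V n ≤ monSpan I {μ | μ.length ≤ d * n} := by
  refine iSup₂_le fun i hi => (subPow_le_monSpan I hV i).trans (monSpan_mono I fun μ hμ => ?_)
  exact le_trans hμ (Nat.mul_le_mul_left d (Finset.mem_Icc.1 hi).2)

theorem exists_le_monSpan (V : Submodule k I.Quotient) [FiniteDimensional k V] :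
    ∃ d, V ≤ monSpan I {μ | μ.length ≤ d} := by
  have key : ∀ x : I.Quotient, ∃ d, x ∈ monSpan I {μ | μ.length ≤ d} := by
    intro x
    obtain ⟨f, rfl⟩ := I.proj_surjective x
    refine ⟨f.coeff.support.sup NF.length, proj_mem_of_support I fun μ hμ =>
      proj_single_mem_monSpan I ?_⟩
    exact Finset.le_sup (f := NF.length) hμ
  choose d hd using key
  obtain ⟨t, ht⟩ := Module.Finite.iff_fg.1 (inferInstance : Module.Finite k V)
  refine ⟨t.sup d, ht ▸ Submodule.span_le.2 fun x hx => ?_⟩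
  have hx' : d x ≤ t.sup d := Finset.le_sup (Finset.mem_coe.1 hx)
  exact monSpan_mono I (fun μ (hμ : μ.length ≤ d x) => hμ.trans hx') (hd x)

theorem mem_subPow_of_mul {A : Type*} [NonUnitalNonAssocRing A] [Module k A] {V : Submodule k A}
    {m n : ℕ} (hm : 1 ≤ m) (hn : 1 ≤ n) {x y : A} (hx : x ∈ subPow V m) (hy : y ∈ subPow V n) :
    x * y ∈ subPow V (m + n) := by
  obtain ⟨m, rfl⟩ := Nat.exists_eq_add_of_le' hm
  obtain ⟨n, rfl⟩ := Nat.exists_eq_add_of_le' hn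
  have e : m + 1 + (n + 1) = (m + n) + 2 := by omega
  rw [e, subPow]
  refine Submodule.mem_iSup_of_mem (⟨m, by omega⟩ : Fin (m + n + 1))
    (Submodule.subset_span ⟨x, hx, y, ?_, rfl⟩)
  have e' : m + n + 1 - m = n + 1 := by omega
  change y ∈ subPow V (m + n + 1 - m)
  rwa [e']

/-- Peel off letters of the left word until one remains, then letters of the right word, down to a
product of two letters. -/
theorem NF.induction_letter_mul {motive : NF X → Prop} (letter : ∀ x, motive (letter x))
    (mul : ∀ μ ν, motive μ → motive ν → motive (μ * ν)) (μ : NF X) : motive μ := by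
  cases μ with
  | letter x => exact letter x
  | pair u v hu hv =>
    obtain ⟨a, t, rfl⟩ := NF.exists_eq_cons hu
    obtain ⟨b, s, rfl⟩ := NF.exists_eq_cons hv
    induction t using Multiset.induction generalizing a with
    | empty =>
      induction s using Multiset.induction generalizing b with
      | empty => exact mul _ _ (letter a) (letter b)
      | cons w s ih =>
        exact mul _ _ (ih w Multiset.cons_ne_zero) (letter b)
    | cons w t ih => exact mul _ _ (letter a) (ih w Multiset.cons_ne_zero)

theorem NF.one_le_length (μ : NF X) : 1 ≤ μ.length := by
  cases μ with
  | letter x => exact le_rfl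
  | pair u v hu hv =>
    have h : 2 ≤ (NF.pair u v hu hv).length := NF.IsPair.two_le_length trivial
    omega

theorem proj_single_mem_subPow (μ : NF X) :
    I.proj (MonoidAlgebra.single μ 1) ∈ subPow (monSpan I (Set.range NF.letter)) μ.length := by
  induction μ using NF.induction_letter_mul with
  | letter x =>
    rw [show (NF.letter x).length = 1 from rfl, subPow]
    exact proj_single_mem_monSpan I (Set.mem_range_self x)
  | mul μ ν hμ hν =>
    have e : (MonoidAlgebra.single (μ * ν) 1 : BC k X) =
        MonoidAlgebra.single μ 1 * MonoidAlgebra.single ν 1 := by simp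
    rw [e, AlgIdeal.proj_mul, NF.length_mul]
    exact mem_subPow_of_mul μ.one_le_length ν.one_le_length hμ hν

theorem monSpan_le_subPowLE (n : ℕ) :
    monSpan I {μ | μ.length ≤ n} ≤ subPowLE (monSpan I (Set.range NF.letter)) n := by
  refine Submodule.span_le.2 ?_
  rintro _ ⟨μ, hμ, rfl⟩
  exact Submodule.mem_iSup_of_mem μ.length (Submodule.mem_iSup_of_mem
    (Finset.mem_Icc.2 ⟨μ.one_le_length, hμ⟩) (proj_single_mem_subPow I μ))

theorem finite_length_le [Finite X] (n : ℕ) : {μ : NF X | μ.length ≤ n}.Finite := by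
  have := Fintype.ofFinite X
  have hp : {μ : NF X | μ.IsPair ∧ μ.length ≤ n}.Finite := by
    refine Set.Finite.of_finite_image (f := NF.expo) ((finite_sum_le Set.univ n).subset ?_) ?_
    · rintro _ ⟨μ, ⟨hμ, hl⟩, rfl⟩
      exact ⟨trivial, by rwa [← NF.length_eq_sum_expo hμ]⟩
    · exact fun μ hμ ν hν h => NF.eq_of_expo_eq hμ.1 hν.1 h
  refine ((Set.finite_range (NF.letter : X → NF X)).union hp).subset fun μ hμ => ?_
  cases μ with
  | letter x => exact Or.inl ⟨x, rfl⟩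
  | pair u v hu hv =>
    have h : (NF.pair u v hu hv).IsPair ∧ (NF.pair u v hu hv).length ≤ n := ⟨trivial, hμ⟩
    exact Set.mem_union_right _ h

end MonSpan

/-! ### Irreducible normal forms -/

section Irreducible

variable {k X : Type*} [Field k] [LinearOrder (NF X)]

/-- A normal form that is not the leading monomial of a normal `S`-polynomial. -/
def IsIrr (S : Set (BC k X)) (μ : NF X) : Prop :=
  ∀ h : BC k X, IsNormalPoly S h → leadMon h ≠ (μ : WithBot (NF X))

/-- A nonzero combination of irreducible monomials that vanishes in the quotient lies in Id(S), so
its leading monomial would be that of a normal polynomial, contrary to irreducibility. -/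
theorem IsGSBasis.linearIndependent {S : Set (BC k X)} (hS : IsGSBasis S) {T : Set (NF X)}
    (hT : ∀ μ ∈ T, IsIrr S μ) :
    LinearIndependent k fun μ : T =>
      (AlgIdeal.span k S).proj (MonoidAlgebra.single (μ : NF X) 1) := by
  have hli : LinearIndependent k fun μ : T => (MonoidAlgebra.single (μ : NF X) 1 : BC k X) := by
    have := (MonoidAlgebra.basis (NF X) k).linearIndependent.comp (fun μ : T => (μ : NF X))
      Subtype.val_injective
    convert this using 2 with μ
    simp [MonoidAlgebra.basis_apply]
  refine hli.map (f := (AlgIdeal.span k S).proj) (Submodule.disjoint_def.2 fun f hf hf' => ?_)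
  by_contra hne
  have hmem : f ∈ (AlgIdeal.span k S).toSubmodule := by
    have : (AlgIdeal.span k S).proj f = (AlgIdeal.span k S).proj 0 := by
      rw [map_zero]; exact hf'
    simpa using (AlgIdeal.proj_eq_proj _).1 this
  have hsupp : f ∈ MonoidAlgebra.supported k k T := by
    rw [MonoidAlgebra.supported_eq_span_single, Set.image_eq_range]
    exact hf
  obtain ⟨h, hh, hlead⟩ := hS.lead f hmem hne
  obtain ⟨μ, hμ⟩ := exists_leadMon_eq hne
  exact hT μ (MonoidAlgebra.mem_supported.1 hsupp (leadMon_eq_coe_iff.1 hμ).1) h hh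
    (hlead.symm.trans hμ)

theorem IsGSBasis.ncard_le_finrank {S : Set (BC k X)} (hS : IsGSBasis S) {T U : Set (NF X)}
    (hT : ∀ μ ∈ T, IsIrr S μ) (hTU : T ⊆ U) (hU : U.Finite) :
    T.ncard ≤ Module.finrank k (monSpan (AlgIdeal.span k S) U) := by
  have := (hU.subset hTU).fintype
  have := finiteDimensional_monSpan (AlgIdeal.span k S) hU
  have h := finrank_span_eq_card (hS.linearIndependent hT)
  rw [← Nat.card_coe_set_eq, Nat.card_eq_fintype_card, ← h]
  refine Submodule.finrank_mono (Submodule.span_le.2 ?_)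
  rintro _ ⟨μ, rfl⟩
  exact proj_single_mem_monSpan _ (hTU μ.2)

/-- Shifts of a pair M reach exactly the pairs whose exponents lie above that of M. Elements of S
that lead with a letter play no part, because normal polynomials do not extend them. -/
theorem isIrr_iff [Fintype X] (hord : IsMonomialOrder X) {S : Set (BC k X)} {μ : NF X}
    (hμ : μ.IsPair) : IsIrr S μ ↔
      ∀ s ∈ S, ∀ M : NF X, leadMon s = M → M.IsPair → ¬ M.expo ≤ μ.expo := by
  constructor
  · intro h s hs M hM hp hle
    obtain ⟨zs, ys, e⟩ := NF.exists_shift_eq hp hμ hle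
    exact h _ (.extend s hs M hM hp.two_le_length zs ys)
      (e ▸ leadMon_rNormed_lNormed hord zs ys hM)
  · intro h f hf hlead
    obtain ⟨s, hs, M, hM, hp, zs, ys, -, rfl⟩ := hf.exists_eq hord hlead hμ
    refine h s hs M hM hp ?_
    rw [NF.expo_shift _ _ (Or.inl hp)]
    exact le_self_add

/-- The exponent vectors of irreducible pairs. -/
def irrExpos (S : Set (BC k X)) : Set (X ⊕ X → ℕ) :=
  {d | (∃ x, d (Sum.inl x) ≠ 0) ∧ (∃ x, d (Sum.inr x) ≠ 0) ∧
    ∀ s ∈ S, ∀ M : NF X, leadMon s = M → M.IsPair → ¬ M.expo ≤ d}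

/-- The bound on leading exponents lets the truncation decide divisibility; `1 ≤ K` lets it detect
nonzero halves. -/
theorem irrExpos_congr {S : Set (BC k X)} {K : ℕ} (hK : 1 ≤ K)
    (hS : ∀ s ∈ S, ∀ M : NF X, leadMon s = M → ∀ i, M.expo i ≤ K) (d d' : X ⊕ X → ℕ)
    (h : ∀ i, min (d i) K = min (d' i) K) (hd : d ∈ irrExpos S) : d' ∈ irrExpos S := by
  obtain ⟨⟨x, hx⟩, ⟨y, hy⟩, hd⟩ := hd
  refine ⟨⟨x, ?_⟩, ⟨y, ?_⟩, fun s hs M hM hp hle => hd s hs M hM hp fun i => ?_⟩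
  · have := h (Sum.inl x); omega
  · have := h (Sum.inr y); omega
  · change M.expo i ≤ d i
    have := h i
    have : M.expo i ≤ d' i := hle i
    have := hS s hs M hM i
    omega

variable [Fintype X]

/-- A positive weight for which the leading monomials of a finite set, as far as they are not
letters, are heavier than the other monomials. -/
theorem exists_weight (hord : IsMonomialOrder X) (S : Finset (BC k X)) :
    ∃ w : X ⊕ X → ℚ, (∀ i, 0 < w i) ∧ ∀ s ∈ S, ∀ M : NF X, leadMon s = M → M.IsPair →
      ∀ ν ∈ s.coeff.support, ν ≠ M → ∀ e ∈ ν.expos,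
        ∑ i, w i * (e i : ℚ) < ∑ i, w i * (M.expo i : ℚ) := by
  classical
  -- The unit vectors are included to make `w` positive; filtering by `PosDiff` makes the semigroup
  -- condition automatic.
  obtain ⟨w, hw⟩ := exists_functional_pos (P := NF.PosDiff (X := X))
    (fun _ _ h h' => h.add hord h') NF.not_posDiff_zero Finset.univ
    ((Finset.univ.image (fun i : X ⊕ X => (Pi.single i 1 : X ⊕ X → ℤ)) ∪
      S.biUnion fun s => (s.coeff.support ×ˢ s.coeff.support).biUnion fun p =>
        p.1.expos.image fun e i => (p.2.expo i : ℤ) - e i).filter NF.PosDiff)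
    (fun d hd => ⟨(Finset.mem_filter.1 hd).2, fun i hi => (hi (Finset.mem_univ i)).elim⟩)
  refine ⟨w, fun i => ?_, fun s hs M hM hp ν hν hne e he => ?_⟩
  · have := hw (Pi.single i 1) (Finset.mem_filter.2 ⟨Finset.mem_union_left _
      (Finset.mem_image_of_mem _ (Finset.mem_univ i)), by
        convert NF.posDiff_single hord i⟩)
    simpa [Pi.single_apply] using this
  · obtain ⟨hMs, hmax⟩ := leadMon_eq_coe_iff.1 hM
    have := hw (fun i => (M.expo i : ℤ) - e i) (Finset.mem_filter.2 ⟨Finset.mem_union_right _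
      (Finset.mem_biUnion.2 ⟨s, hs, Finset.mem_biUnion.2 ⟨(ν, M),
        Finset.mem_product.2 ⟨hν, hMs⟩, Finset.mem_image_of_mem _ he⟩⟩),
      NF.posDiff_of_lt hord hp ((hmax ν hν).lt_of_ne hne) he⟩)
    simp only [Int.cast_sub, Int.cast_natCast, mul_sub, Finset.sum_sub_distrib] at this
    linarith

/-- A reducible normal form is the leading monomial of a monic element of the ideal none of whose
monomials is heavier. -/
theorem exists_reducer (hord : IsMonomialOrder X) {S : Finset (BC k X)}
    (hmonic : ∀ s ∈ S, IsMonic s) {w : X ⊕ X → ℚ}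
    (hw : ∀ s ∈ S, ∀ M : NF X, leadMon s = M → M.IsPair →
      ∀ ν ∈ s.coeff.support, ν ≠ M → ∀ e ∈ ν.expos,
        ∑ i, w i * (e i : ℚ) < ∑ i, w i * (M.expo i : ℚ))
    {μ : NF X} (hμ : μ.IsPair) (hred : ¬ IsIrr (S : Set (BC k X)) μ) :
    ∃ h ∈ (AlgIdeal.span k (S : Set (BC k X))).toSubmodule, h.coeff μ = 1 ∧
      ∀ ν ∈ h.coeff.support, ν ≠ μ → ν < μ ∧
        (ν.IsPair → ∑ i, w i * (ν.expo i : ℚ) ≤ ∑ i, w i * (μ.expo i : ℚ)) := by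
  simp only [IsIrr, not_forall, not_not] at hred
  obtain ⟨h, hh, hlead⟩ := hred
  obtain ⟨s, hs, M, hM, hp, zs, ys, rfl, rfl⟩ := hh.exists_eq hord hlead hμ
  refine ⟨_, rNormed_lNormed_mem _ (subset_span _ hs) zs ys, ?_, fun ν hν hne => ?_⟩
  · rw [coeff_rNormed_lNormed hord]
    obtain ⟨M', hM', h1⟩ := hmonic s hs
    rw [hM] at hM'
    rwa [WithBot.coe_injective hM']
  · have hlt := ((leadMon_eq_coe_iff.1 hlead).2 ν hν).lt_of_ne hne
    refine ⟨hlt, fun hνp => ?_⟩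
    rw [support_rNormed_lNormed hord] at hν
    obtain ⟨ρ, hρ, rfl⟩ := Finset.mem_image.1 hν
    obtain ⟨e, he, heq⟩ := NF.exists_expos_shift hνp
    have := hw s hs M hM hp ρ hρ (by rintro rfl; exact hne rfl) e he
    rw [heq, NF.expo_shift _ _ (Or.inl hp)]
    simp only [Pi.add_apply, Nat.cast_add, mul_add, Finset.sum_add_distrib]
    linarith

/-- Reduction terminates because the order is a well order, and the weight bound survives each step.
Letters carry no weight condition: they are finitely many and are all kept in the spanning set. -/
theorem proj_single_mem_of_weight_le (hord : IsMonomialOrder X) {S : Finset (BC k X)}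
    (hmonic : ∀ s ∈ S, IsMonic s) {w : X ⊕ X → ℚ}
    (hw : ∀ s ∈ S, ∀ M : NF X, leadMon s = M → M.IsPair →
      ∀ ν ∈ s.coeff.support, ν ≠ M → ∀ e ∈ ν.expos,
        ∑ i, w i * (e i : ℚ) < ∑ i, w i * (M.expo i : ℚ))
    (N : ℚ) (μ : NF X) (hμ : μ.IsPair → ∑ i, w i * (μ.expo i : ℚ) ≤ N) :
    (AlgIdeal.span k (S : Set (BC k X))).proj (MonoidAlgebra.single μ 1) ∈
      monSpan (AlgIdeal.span k (S : Set (BC k X))) (Set.range NF.letter ∪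
        {ν | ν.IsPair ∧ IsIrr (S : Set (BC k X)) ν ∧ ∑ i, w i * (ν.expo i : ℚ) ≤ N}) := by
  induction μ using hord.wf.induction with
  | ind μ ih =>
    by_cases hp : μ.IsPair
    · by_cases hirr : IsIrr (S : Set (BC k X)) μ
      · exact proj_single_mem_monSpan _ (Or.inr ⟨hp, hirr, hμ hp⟩)
      · obtain ⟨h, hh, h1, hlow⟩ := exists_reducer hord hmonic hw hp hirr
        -- The reducer is `μ` plus other terms and vanishes in the quotient, so `μ` becomes minus
        -- those terms.
        have e := MonoidAlgebra.single_add_erase μ h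
        rw [h1] at e
        have e0 : (AlgIdeal.span k (S : Set (BC k X))).proj h = 0 := by
          rw [← map_zero (AlgIdeal.span k (S : Set (BC k X))).proj, AlgIdeal.proj_eq_proj]
          simpa using hh
        rw [← e, map_add] at e0
        rw [eq_neg_of_add_eq_zero_left e0]
        refine Submodule.neg_mem _ (proj_mem_of_support _ fun ν hν => ?_)
        rw [MonoidAlgebra.coeff_erase, Finsupp.support_erase, Finset.mem_erase] at hν
        obtain ⟨hlt, hwt⟩ := hlow ν hν.2 hν.1
        exact ih ν hlt fun hνp => (hwt hνp).trans (hμ hp)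
    · cases μ with
      | letter x => exact proj_single_mem_monSpan _ (Or.inl ⟨x, rfl⟩)
      | pair u v hu hv => exact (hp trivial).elim

/-- The irreducible pairs of bounded length. -/
def irrPairs (S : Set (BC k X)) (n : ℕ) : Set (NF X) :=
  {μ | μ.IsPair ∧ IsIrr S μ ∧ μ.length ≤ n}

theorem exists_finrank_monSpan_le (hord : IsMonomialOrder X) {S : Finset (BC k X)}
    (hmonic : ∀ s ∈ S, IsMonic s) :
    ∃ C : ℕ, ∀ n : ℕ, Module.finrank k
      (monSpan (AlgIdeal.span k (S : Set (BC k X))) {μ | μ.length ≤ n}) ≤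
        Fintype.card X + (irrPairs (S : Set (BC k X)) (C * n)).ncard := by
  obtain ⟨w, hpos, hw⟩ := exists_weight hord S
  obtain ⟨δ, hδ, hδw⟩ : ∃ δ : ℚ, 0 < δ ∧ ∀ i, δ ≤ w i := by
    rcases isEmpty_or_nonempty (X ⊕ X) with _ | _
    · exact ⟨1, one_pos, isEmptyElim⟩
    · obtain ⟨i, hi⟩ := Finite.exists_min w
      exact ⟨w i, hpos i, hi⟩
  -- All weights lie between δ and C δ: length at most n gives weight at most C δ n, and this in
  -- turn gives length at most C n.
  obtain ⟨C, hC⟩ := exists_nat_ge ((∑ i, w i) / δ)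
  rw [div_le_iff₀ hδ] at hC
  have hle : ∀ i, w i ≤ C * δ := fun i =>
    (Finset.single_le_sum (fun j _ => (hpos j).le) (Finset.mem_univ i)).trans hC
  refine ⟨C, fun n => ?_⟩
  have hfin : (Set.range (NF.letter : X → NF X) ∪ irrPairs (S : Set (BC k X)) (C * n)).Finite :=
    (Set.finite_range _).union ((finite_length_le (C * n)).subset fun μ hμ => hμ.2.2)
  have hsub : monSpan (AlgIdeal.span k (S : Set (BC k X))) {μ | μ.length ≤ n} ≤
      monSpan (AlgIdeal.span k (S : Set (BC k X)))
        (Set.range NF.letter ∪ irrPairs (S : Set (BC k X)) (C * n)) := by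
    refine Submodule.span_le.2 ?_
    rintro _ ⟨μ, hμ, rfl⟩
    refine monSpan_mono _ ?_ (proj_single_mem_of_weight_le hord hmonic hw (C * δ * n) μ ?_)
    · refine Set.union_subset_union_right _ ?_
      rintro ν ⟨hp, hirr, hν⟩
      refine ⟨hp, hirr, ?_⟩
      have h1 : δ * ν.length ≤ ∑ i, w i * (ν.expo i : ℚ) := by
        rw [NF.length_eq_sum_expo hp, Nat.cast_sum, Finset.mul_sum]
        exact Finset.sum_le_sum fun i _ =>
          mul_le_mul_of_nonneg_right (hδw i) (Nat.cast_nonneg _)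
      have h2 : δ * (ν.length : ℚ) ≤ δ * ((C * n : ℕ) : ℚ) := by
        push_cast
        linarith
      exact_mod_cast le_of_mul_le_mul_left h2 hδ
    · intro hp
      calc ∑ i, w i * (μ.expo i : ℚ) ≤ ∑ i, C * δ * (μ.expo i : ℚ) :=
            Finset.sum_le_sum fun i _ => mul_le_mul_of_nonneg_right (hle i) (Nat.cast_nonneg _)
        _ = C * δ * μ.length := by
            rw [NF.length_eq_sum_expo hp, Nat.cast_sum, Finset.mul_sum]
        _ ≤ C * δ * n := by
            have : (μ.length : ℚ) ≤ n := by exact_mod_cast hμ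
            gcongr
  have := finiteDimensional_monSpan (AlgIdeal.span k (S : Set (BC k X))) hfin
  refine (Submodule.finrank_mono hsub).trans ((finrank_monSpan_le _ hfin).trans
    ((Set.ncard_union_le _ _).trans ?_))
  gcongr
  rw [← Set.image_univ]
  refine (Set.ncard_image_le Set.finite_univ).trans ?_
  rw [Set.ncard_univ, Nat.card_eq_fintype_card]

theorem ncard_irrPairs (hord : IsMonomialOrder X) (S : Set (BC k X)) (n : ℕ) :
    (irrPairs S n).ncard = {d ∈ irrExpos S | ∑ i, d i ≤ n}.ncard := by
  have e : {d ∈ irrExpos S | ∑ i, d i ≤ n} = NF.expo '' irrPairs S n := by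
    ext d
    constructor
    · rintro ⟨⟨h1, h2, h3⟩, hn⟩
      obtain ⟨μ, hμ, rfl⟩ := NF.exists_isPair_expo_eq h1 h2
      exact ⟨μ, ⟨hμ, (isIrr_iff hord hμ).2 h3, by rwa [NF.length_eq_sum_expo hμ]⟩, rfl⟩
    · rintro ⟨μ, ⟨hμ, hirr, hn⟩, rfl⟩
      exact ⟨⟨NF.exists_expo_inl_ne_zero hμ, NF.exists_expo_inr_ne_zero hμ,
        (isIrr_iff hord hμ).1 hirr⟩, by rwa [← NF.length_eq_sum_expo hμ]⟩
  rw [e, Set.InjOn.ncard_image fun μ hμ ν hν h => NF.eq_of_expo_eq hμ.1 hν.1 h]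

theorem exists_truncation (S : Finset (BC k X)) :
    ∃ K : ℕ, 1 ≤ K ∧ ∀ s ∈ S, ∀ M : NF X, leadMon s = M → ∀ i, M.expo i ≤ K := by
  refine ⟨1 + S.sup fun s => s.coeff.support.sup fun ν => Finset.univ.sup ν.expo,
    by omega, fun s hs M hM i => ?_⟩
  have h1 : M.expo i ≤ Finset.univ.sup M.expo := Finset.le_sup (Finset.mem_univ i)
  have h2 := Finset.le_sup (f := fun ν : NF X => Finset.univ.sup ν.expo)
    (leadMon_eq_coe_iff.1 hM).1
  have h3 := Finset.le_sup (f := fun s : BC k X =>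
    s.coeff.support.sup fun ν => Finset.univ.sup ν.expo) hs
  omega

end Irreducible

/-! ### The dimension as a count of large coordinates -/

section Dimension

variable {k X : Type*} [Field k] [LinearOrder (NF X)] [Fintype X]

theorem gkDim_bcQuot_le (hord : IsMonomialOrder X) {S : Finset (BC k X)}
    (hmonic : ∀ s ∈ S, IsMonic s) {K m : ℕ}
    (hm : ∀ d ∈ irrExpos (S : Set (BC k X)), (largeCoords K d).card ≤ m) :
    gkDim k (BCQuot (S : Set (BC k X))) ≤ m := by
  obtain ⟨C, hC⟩ := exists_finrank_monSpan_le hord hmonic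
  refine gkDim_le fun V hV => ?_
  obtain ⟨d, hd⟩ := exists_le_monSpan (AlgIdeal.span k (S : Set (BC k X))) V
  set B := 2 ^ Fintype.card (X ⊕ X) * (K + 1) ^ Fintype.card (X ⊕ X) with hB
  -- The first summand accounts for the letters, and the final 1 ensures that the constant is at
  -- least 1.
  refine ⟨((Fintype.card X + B * (C * d + 1) ^ m + 1 : ℕ) : ℝ), by exact_mod_cast Nat.le_add_left 1 _, fun n hn => ?_⟩
  have := finiteDimensional_monSpan (AlgIdeal.span k (S : Set (BC k X)))
    (finite_length_le (X := X) (d * n))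
  have h1 := (Submodule.finrank_mono (subPowLE_le_monSpan _ hd n)).trans (hC (d * n))
  rw [ncard_irrPairs hord] at h1
  have h2 := ncard_sum_le_le hm (C * (d * n))
  have hn' : 1 ≤ n ^ m := Nat.one_le_pow _ _ hn
  have h3 : (C * (d * n) + 1) ^ m ≤ (C * d + 1) ^ m * n ^ m := by
    rw [← mul_pow]
    refine Nat.pow_le_pow_left ?_ _
    nlinarith
  have h4 : Module.finrank k (subPowLE V n) ≤
      (Fintype.card X + B * (C * d + 1) ^ m + 1) * n ^ m := by
    calc _ ≤ Fintype.card X + B * (C * (d * n) + 1) ^ m := h1.trans (by gcongr)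
      _ ≤ Fintype.card X * n ^ m + B * ((C * d + 1) ^ m * n ^ m) := by
          gcongr
          exact Nat.le_mul_of_pos_right _ hn'
      _ ≤ _ := by nlinarith
  exact_mod_cast h4

theorem le_gkDim_bcQuot [Nonempty X] (hord : IsMonomialOrder X) {S : Finset (BC k X)}
    (hS : IsGSBasis (S : Set (BC k X))) {K : ℕ}
    (hK : ∀ d d' : X ⊕ X → ℕ, (∀ i, min (d i) K = min (d' i) K) →
      d ∈ irrExpos (S : Set (BC k X)) → d' ∈ irrExpos (S : Set (BC k X)))
    {c : X ⊕ X → ℕ} (hc : c ∈ irrExpos (S : Set (BC k X))) :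
    ((largeCoords K c).card : EReal) ≤ gkDim k (BCQuot (S : Set (BC k X))) := by
  set r := Fintype.card (X ⊕ X) with hr
  have hr0 : 0 < r := Fintype.card_pos
  set m := (largeCoords K c).card
  refine le_gkDim (V := monSpan _ (Set.range NF.letter))
    (finiteDimensional_monSpan _ (Set.finite_range _))
    (c := (1 / (2 * r : ℝ)) ^ m) (by positivity) ?_
  -- Half of n pays for the fixed part r K + ∑ c, where r counts all coordinates; the other half
  -- allows a box of side n / (2 r).
  filter_upwards [Filter.eventually_ge_atTop (2 * (r * K + ∑ i, c i))] with n hn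
  have hdiv : r * (n / (2 * r)) ≤ n / 2 := by
    rw [Nat.le_div_iff_mul_le two_pos]
    calc r * (n / (2 * r)) * 2 = 2 * r * (n / (2 * r)) := by ring
      _ ≤ n := Nat.mul_div_le _ _
  have h1 := le_ncard_sum_le hK hc (n := n) (k := n / (2 * r)) (by
    rw [← hr, mul_add]; omega)
  rw [← ncard_irrPairs hord] at h1
  have h2 := hS.ncard_le_finrank (T := irrPairs (S : Set (BC k X)) n) (fun μ hμ => hμ.2.1)
    (fun μ hμ => hμ.2.2) (finite_length_le n)
  have hfin : FiniteDimensional k (subPowLE (monSpan (AlgIdeal.span k (S : Set (BC k X)))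
      (Set.range NF.letter)) n) := by
    have := finiteDimensional_monSpan (AlgIdeal.span k (S : Set (BC k X)))
      (finite_length_le (X := X) (1 * n))
    refine Submodule.finiteDimensional_of_le 
      (subPowLE_le_monSpan (d := 1) _ (monSpan_mono _ ?_) n)
    rintro _ ⟨x, rfl⟩
    exact le_refl 1
  have h3 := Submodule.finrank_mono (monSpan_le_subPowLE
    (AlgIdeal.span k (S : Set (BC k X))) n)
  have h4 : (n : ℝ) / (2 * r) ≤ (n / (2 * r) : ℕ) + 1 := by
    have := Nat.lt_floor_add_one ((n : ℝ) / (2 * r : ℕ))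
    rw [Nat.floor_div_eq_div] at this
    push_cast at this
    exact this.le
  calc (1 / (2 * r : ℝ)) ^ m * (n : ℝ) ^ m = ((n : ℝ) / (2 * r)) ^ m := by
        rw [← mul_pow]; congr 1; ring
    _ ≤ (((n / (2 * r) : ℕ) : ℝ) + 1) ^ m := by gcongr
    _ ≤ _ := by exact_mod_cast (h1.trans h2).trans h3

/-- The Gelfand–Kirillov dimension is the largest number of coordinates that can be large in an
irreducible exponent vector. -/
theorem exists_gkDim_eq [Nonempty X] (hord : IsMonomialOrder X) {S : Finset (BC k X)}
    (hS : IsGSBasis (S : Set (BC k X))) {K : ℕ} (hK : 1 ≤ K)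
    (hSK : ∀ s ∈ S, ∀ M : NF X, leadMon s = M → ∀ i, M.expo i ≤ K) :
    ∃ m : ℕ, gkDim k (BCQuot (S : Set (BC k X))) = m ∧
      (∀ c ∈ irrExpos (S : Set (BC k X)), (largeCoords K c).card ≤ m) ∧
      (m = 0 ∨ ∃ c ∈ irrExpos (S : Set (BC k X)), (largeCoords K c).card = m) := by
  rcases (irrExpos (S : Set (BC k X))).eq_empty_or_nonempty with h | h
  -- Without irreducible pairs the letters alone span the quotient.
  · refine ⟨0, le_antisymm ?_ (by simpa using gkDim_nonneg), by simp [h], Or.inl rfl⟩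
    exact gkDim_bcQuot_le hord hS.monic (K := K) (by simp [h])
  · have hbdd : BddAbove ((fun c => (largeCoords K c).card) '' irrExpos (S : Set (BC k X))) :=
      ⟨Fintype.card (X ⊕ X), by rintro _ ⟨c, -, rfl⟩; exact Finset.card_le_univ _⟩
    obtain ⟨c, hc, hcm⟩ := Nat.sSup_mem (h.image _) hbdd
    have hmax : ∀ d ∈ irrExpos (S : Set (BC k X)),
        (largeCoords K d).card ≤ (largeCoords K c).card := fun d hd => by
      have := le_csSup hbdd ⟨d, hd, rfl⟩
      rwa [← hcm] at this
    exact ⟨_, le_antisymm (gkDim_bcQuot_le hord hS.monic hmax)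
      (le_gkDim_bcQuot hord hS (irrExpos_congr hK hSK) hc), hmax, Or.inr ⟨c, hc, rfl⟩⟩

/-- A vector with all coordinates at least K lies above every leading exponent, so it cannot be
irreducible once some leading monomial is a pair. -/
theorem card_largeCoords_lt {S : Set (BC k X)} {K : ℕ}
    (hSK : ∀ s ∈ S, ∀ M : NF X, leadMon s = M → ∀ i, M.expo i ≤ K)
    (hex : ∃ s ∈ S, ∃ M : NF X, leadMon s = M ∧ M.IsPair) {c : X ⊕ X → ℕ}
    (hc : c ∈ irrExpos S) : (largeCoords K c).card < 2 * Fintype.card X := by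
  have hcard : Fintype.card (X ⊕ X) = 2 * Fintype.card X := by
    rw [Fintype.card_sum, two_mul]
  rw [← hcard]
  obtain ⟨s, hs, M, hM, hp⟩ := hex
  obtain ⟨i, hi⟩ : ∃ i, ¬ M.expo i ≤ c i := not_forall.1 (hc.2.2 s hs M hM hp)
  refine Finset.card_lt_univ_of_notMem (x := i) fun hmem => hi ?_
  exact (hSK s hs M hM i).trans (mem_largeCoords.1 hmem)

/-- Few leading monomials can be avoided by setting few coordinates to zero. -/
theorem exists_mem_irrExpos (hX : 1 < Fintype.card X) {S : Finset (BC k X)}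
    (hmonic : ∀ s ∈ S, IsMonic s) (hS1 : S.Nonempty) (hS2 : S.card ≤ Fintype.card X)
    {K : ℕ} (hK : 1 ≤ K) (hletter : ∀ s ∈ S, ∀ x : X, leadMon s ≠ (NF.letter x : WithBot (NF X))) :
    ∃ c ∈ irrExpos (S : Set (BC k X)), 2 * Fintype.card X - S.card ≤ (largeCoords K c).card := by
  classical
  have hlead : ∀ s ∈ S, ∃ M : NF X, leadMon s = M ∧ M.IsPair := by
    intro s hs
    obtain ⟨M, hM, -⟩ := hmonic s hs
    refine ⟨M, hM, ?_⟩
    cases M with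
    | letter x => exact hletter s hs x hM
    | pair u v hu hv => trivial
  obtain ⟨s₀, hs₀⟩ := hS1
  have hl : ∀ s ∈ S, ∃ x, ∀ M : NF X, leadMon s = M → M.expo (Sum.inl x) ≠ 0 := by
    intro s hs
    obtain ⟨M, hM, hp⟩ := hlead s hs
    obtain ⟨x, hx⟩ := NF.exists_expo_inl_ne_zero hp
    refine ⟨x, fun M' hM' => ?_⟩
    rw [hM] at hM'
    rwa [← WithBot.coe_injective hM']
  obtain ⟨y, hy⟩ : ∃ y, ∀ M : NF X, leadMon s₀ = M → M.expo (Sum.inr y) ≠ 0 := by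
    obtain ⟨M, hM, hp⟩ := hlead s₀ hs₀
    obtain ⟨x, hx⟩ := NF.exists_expo_inr_ne_zero hp
    refine ⟨x, fun M' hM' => ?_⟩
    rw [hM] at hM'
    rwa [← WithBot.coe_injective hM']
  have : Nonempty X := ⟨y⟩
  choose! f hf using hl
  set L : Finset X := (S.erase s₀).image f with hL
  have hLc : L.card ≤ S.card - 1 := by
    rw [← Finset.card_erase_of_mem hs₀]; exact Finset.card_image_le
  have hSpos : 0 < S.card := Finset.card_pos.2 ⟨s₀, hs₀⟩
  -- The element `s₀` is avoided by a right coordinate and all others by left ones. So at most t - 1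
  -- < r left coordinates and a single right one vanish, and both halves stay nonzero, the right one
  -- because r > 1.
  set Z : Finset (X ⊕ X) := insert (Sum.inr y) (L.map ⟨Sum.inl, Sum.inl_injective⟩) with hZ
  have hZc : Z.card ≤ S.card := by
    refine (Finset.card_insert_le _ _).trans ?_
    rw [Finset.card_map]; omega
  refine ⟨fun i => if i ∈ Z then 0 else K, ⟨?_, ?_, ?_⟩, ?_⟩
  · obtain ⟨x, hx⟩ : ∃ x, x ∉ L := by
      by_contra! h
      have := Finset.card_le_card (fun x _ => h x : Finset.univ ⊆ L)
      rw [Finset.card_univ] at this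
      omega
    refine ⟨x, ?_⟩
    simp [hZ, hx]; omega
  · obtain ⟨x, hx⟩ := Fintype.exists_ne_of_one_lt_card hX y
    refine ⟨x, ?_⟩
    simp [hZ, hx]; omega
  · intro s hs M hM hp hle
    by_cases hss : s = s₀
    · subst hss
      have : M.expo (Sum.inr y) ≤ _ := hle (Sum.inr y)
      simp [hZ] at this
      exact hy M hM this
    · have hmem : f s ∈ L := Finset.mem_image_of_mem f (Finset.mem_erase.2 ⟨hss, hs⟩)
      have : M.expo (Sum.inl (f s)) ≤ _ := hle (Sum.inl (f s))
      simp [hZ, hmem] at this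
      exact hf s hs M hM this
  · have hsub : Finset.univ \ Z ⊆ largeCoords K (fun i => if i ∈ Z then 0 else K) := by
      intro i hi
      rw [mem_largeCoords, if_neg (Finset.mem_sdiff.1 hi).2]
    refine le_trans ?_ (Finset.card_le_card hsub)
    rw [Finset.card_sdiff_of_subset (Finset.subset_univ _), Finset.card_univ, Fintype.card_sum]
    omega

end Dimension

end Bicomm

theorem mainTheorem7 {k X : Type*} [Field k] [Fintype X] [LinearOrder (Bicomm.NF X)]
    (hord : Bicomm.IsMonomialOrder X) (hX : 1 < Fintype.card X)
    (S : Finset (Bicomm.BC k X)) (hS : Bicomm.IsGSBasis (S : Set (Bicomm.BC k X))) :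
    (1 ≤ S.card → S.card ≤ Fintype.card X →
      (∀ s ∈ S, ∀ x : X, Bicomm.leadMon s ≠ (Bicomm.NF.letter x : WithBot (Bicomm.NF X))) →
      ∃ m : ℕ, m ∈ Finset.Icc (2 * Fintype.card X - S.card) (2 * Fintype.card X - 1) ∧
        Bicomm.gkDim k (Bicomm.BCQuot (S : Set (Bicomm.BC k X))) = (m : EReal)) ∧
    (Fintype.card X < S.card →
      ∃ m : ℕ, m ∈ Finset.Icc 0 (2 * Fintype.card X - 1) ∧
        Bicomm.gkDim k (Bicomm.BCQuot (S : Set (Bicomm.BC k X))) = (m : EReal)) := by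
  have hne : Nonempty X := Fintype.card_pos_iff.1 (by omega)
  obtain ⟨K, hK, hSK⟩ := Bicomm.exists_truncation S
  obtain ⟨m, hm, hle, hm'⟩ := Bicomm.exists_gkDim_eq hord hS hK hSK
  have hupper : S.Nonempty → m ≤ 2 * Fintype.card X - 1 := by
    intro hSne
    rcases hm' with rfl | ⟨c, hc, rfl⟩
    · omega
    · have := Bicomm.card_largeCoords_lt hSK
        (hS.exists_isPair_leadMon hord (by simpa using hSne)) hc
      omega
  refine ⟨fun h1 h2 h3 => ⟨m, Finset.mem_Icc.2 ⟨?_, hupper (Finset.card_pos.1 h1)⟩, hm⟩,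
    fun h => ⟨m, Finset.mem_Icc.2 ⟨Nat.zero_le _, hupper (Finset.card_pos.1 (by omega))⟩, hm⟩⟩
  obtain ⟨c, hc, hcard⟩ :=
    Bicomm.exists_mem_irrExpos hX hS.monic (Finset.card_pos.1 h1) h2 hK h3
  exact hcard.trans (hle c hc)
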